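/- Let $q$ be a prime power, $k$ an algebraic closure of $\mathbb{F}_q$, $\sigma\in \mathrm{Gal}(k/\mathbb{F}_q)$ the $q$-power Frobenius, $G$ a connected reductive group over $\mathbb{F}_q$ and $\mu\colon \mathbb{G}_{m,k}\to G_k$ a cocharacter. Let $P=P_-(\mu)\subset G_k$ be the parabolic subgroup whose $k$-points are the $g\in G(k)$ such that $t\mapsto \mu(t)^{-1}g\mu(t)$ extends to $\mathbb{A}^1_k$, and let $L$ be the centralizer of $\mu$. Let $(B,T)$ be a Borel pair of $G$ defined over $\mathbb{F}_q$ such that $B\subset P$ and $\mu$ factors through $T$ (such a pair exists after replacing $\mu$ by a $G(k)$-conjugate). Let $\Phi\subset X^*(T)$ be the set of roots and $\Phi^+$ the set of positive roots with respect to the Borel subgroup opposite to $B$, that is, $\alpha\in\Phi^+$ if and only if $U_{-\alpha}\subset B$. Let $\Delta\subset \Phi^+$ be the set of simple roots, $\Phi_L=\{\alpha\in\Phi : \langle\alpha,\mu\rangle=0\}$ the set of roots of $L$, $\Phi_L^+=\Phi_L\cap\Phi^+$, and $I=\Delta\cap\Phi_L$ the type of $P$. Let $w_{0,I}$ be the longest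 element of the subgroup $W_I$ of the Weyl group generated by the reflections $s_\alpha$, $\alpha\in I$. The Frobenius $\sigma$ acts on $X^*(T)$ by $\sigma\lambda=\sigma\circ\lambda\circ\sigma^{-1}$ (on $k$-points). Put $$X^*_{+}(T)=\{\lambda\in X^*(T) : \langle \lambda,\alpha^\vee\rangle\ge 0\ \ \forall \alpha\in \Delta\},\qquad X^*_{+,I}(T)=\{\lambda\in X^*(T) : \langle \lambda,\alpha^\vee\rangle\ge 0\ \ \forall \alpha\in I\},$$ $$X^*_-(L)_{\mathrm{reg}}=\{\lambda\in X^*(L) : \langle\lambda,\alpha^\vee\rangle<0\ \ \forall \alpha\in\Delta\setminus I\},$$ where $X^*(L)=\{\lambda\in X^*(T):\langle\lambda,\alpha^\vee\rangle=0\ \ \forall\alpha\in I\}$. Let $C_{\mathsf{pHa}}\subset X^*(T)$ be the image of $X^*_+(T)$ under $\lambda\mapsto \lambda-q\,w_{0,I}(\sigma^{-1}\lambda)$, let $$\mathcal{C}_{\mathsf{pHa}}=\{\lambda\in X^*(T) : N\lambda\in C_{\mathsf{pHa}}\text{ for some integer } N\ge 1\}$$ be its saturation, and let $$\mathcal{C}_{\mathsf{GS}}=\{\lambda\in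 X^*(T) : \langle \lambda,\alpha^\vee\rangle\ge 0\ \ \forall\alpha\in I,\ \ \langle \lambda,\alpha^\vee\rangle\le 0\ \ \forall\alpha\in\Phi^+\setminus\Phi_L^+\}.$$ For $C\subset X^*(T)$ let $C_{\mathbb{R}_{\ge0}}\subset X^*(T)_{\mathbb{R}}=X^*(T)\otimes_{\mathbb{Z}}\mathbb{R}$ be the set of finite linear combinations of elements of $C$ with coefficients in $\mathbb{R}_{\ge 0}$. Then the following conditions are equivalent: (i) The cone $C_{\mathsf{pHa},\mathbb{R}_{\ge0}}$ is a neighborhood of $X^*_-(L)_{\mathrm{reg}}$ in $X^*_{+,I}(T)_{\mathbb{R}_{\ge0}}$, for the subspace topology from the real vector space $X^*(T)_{\mathbb{R}}$. (ii) $\mathcal{C}_{\mathsf{GS}}\subset\mathcal{C}_{\mathsf{pHa}}$. (iii) $P$ is defined over $\mathbb{F}_q$, and $\sigma(\alpha)=-w_{0,I}\alpha$ for all $\alpha\in I$. -/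

import Mathlib

open scoped MatrixGroups Topology TensorProduct NNReal

namespace HasseType

noncomputable section

/-! ### Linear algebraic groups inside `GL_n` over an algebraically closed field

A (smooth) affine algebraic group over `k` is regarded as a Zariski closed subgroup of some
`GL_n(k)`, identified with its group of `k`-points. -/

section AlgebraicGroups

variable {k : Type*} [Field k] {n : ℕ}

/-- The coordinate ring of `GL_n`, as an algebra of functions: it is generated by the matrix
entries and the inverse of the determinant. -/
def glRing (k : Type*) [Field k] (n : ℕ) : Subalgebra k (GL (Fin n) k → k) :=
  Algebra.adjoin k
    ({f | ∃ i j, f = fun g : GL (Fin n) k => (g : Matrix (Fin n) (Fin n) k) i j} ∪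
      {fun g : GL (Fin n) k => ((g : Matrix (Fin n) (Fin n) k).det)⁻¹})

/-- The Zariski topology on `GL_n(k)`: generated by the non-vanishing loci of regular functions. -/
abbrev zariski (k : Type*) [Field k] (n : ℕ) : TopologicalSpace (GL (Fin n) k) :=
  TopologicalSpace.generateFrom {U | ∃ f ∈ glRing k n, U = {g | f g ≠ 0}}

/-- `H` is a Zariski closed subgroup of `GL_n(k)`. -/
def IsZariskiClosed (H : Subgroup (GL (Fin n) k)) : Prop :=
  IsClosed[zariski k n] (H : Set (GL (Fin n) k))

/-- `H` is connected in the Zariski topology. -/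
def IsZariskiConnected (H : Subgroup (GL (Fin n) k)) : Prop :=
  @IsConnected _ (zariski k n) (H : Set (GL (Fin n) k))

/-- All elements of `H` are unipotent matrices. -/
def IsUnipotent (H : Subgroup (GL (Fin n) k)) : Prop :=
  ∀ g ∈ H, IsNilpotent ((g : Matrix (Fin n) (Fin n) k) - 1)

/-- `G` is a connected reductive group: Zariski closed, connected, and with trivial unipotent
radical, i.e. without non-trivial closed connected normal unipotent subgroups. -/
structure IsConnectedReductive (G : Subgroup (GL (Fin n) k)) : Prop where
  isClosed : IsZariskiClosed G
  isConnected : IsZariskiConnected G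
  unipotentRadical_eq_bot : ∀ N : Subgroup (GL (Fin n) k), N ≤ G → IsZariskiClosed N →
    IsZariskiConnected N → IsUnipotent N → (N.subgroupOf G).Normal → N = ⊥

/-- `T` is a torus: a closed connected group which is diagonalizable, i.e. conjugate in `GL_n(k)`
to a group of diagonal matrices. -/
structure IsTorus (T : Subgroup (GL (Fin n) k)) : Prop where
  isClosed : IsZariskiClosed T
  isConnected : IsZariskiConnected T
  diagonalizable : ∃ x : GL (Fin n) k, ∀ t ∈ T,
    ((x * t * x⁻¹ : GL (Fin n) k) : Matrix (Fin n) (Fin n) k).IsDiag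

/-- `T` is a maximal torus of `G`. -/
structure IsMaximalTorus (G T : Subgroup (GL (Fin n) k)) : Prop where
  le : T ≤ G
  isTorus : IsTorus T
  maximal : ∀ T' : Subgroup (GL (Fin n) k), T' ≤ G → IsTorus T' → T ≤ T' → T' = T

/-- `B` is a Borel subgroup of `G`: maximal among the closed connected solvable subgroups. -/
structure IsBorel (G B : Subgroup (GL (Fin n) k)) : Prop where
  le : B ≤ G
  isClosed : IsZariskiClosed B
  isConnected : IsZariskiConnected B
  isSolvable : Group.IsSolvable B
  maximal : ∀ B' : Subgroup (GL (Fin n) k), B' ≤ G → IsZariskiClosed B' →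
    IsZariskiConnected B' → Group.IsSolvable B' → B ≤ B' → B' = B

/-- A function on the subgroup `H` is regular if it is the restriction of a regular function
on `GL_n`. -/
def IsRegularOn (H : Subgroup (GL (Fin n) k)) (f : H → k) : Prop :=
  ∃ F ∈ glRing k n, ∀ h : H, f h = F h

lemma IsRegularOn.mul {H : Subgroup (GL (Fin n) k)} {f g : H → k}
    (hf : IsRegularOn H f) (hg : IsRegularOn H g) : IsRegularOn H (fun h => f h * g h) := by
  obtain ⟨F, hF, hF'⟩ := hf
  obtain ⟨K, hK, hK'⟩ := hg
  exact ⟨F * K, mul_mem hF hK, fun h => by simp [hF', hK']⟩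

/-- The algebraic characters `H → 𝔾_m`: those homomorphisms `χ` for which `χ` and `χ⁻¹` are
regular functions. -/
def charGroup (H : Subgroup (GL (Fin n) k)) : Subgroup (H →* kˣ) where
  carrier := {χ | IsRegularOn H (fun h => (χ h : k)) ∧
    IsRegularOn H (fun h => (((χ h)⁻¹ : kˣ) : k))}
  one_mem' := ⟨⟨1, one_mem _, fun h => by simp⟩, ⟨1, one_mem _, fun h => by simp⟩⟩
  mul_mem' := by
    rintro χ ψ ⟨h1, h2⟩ ⟨h3, h4⟩
    refine ⟨?_, ?_⟩
    · simpa using h1.mul h3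
    · simpa [mul_comm] using h2.mul h4
  inv_mem' := by
    rintro χ ⟨h1, h2⟩
    exact ⟨by simpa using h2, by simpa using h1⟩

/-- The character lattice `X^*(H)`, written additively. -/
abbrev CharLattice (H : Subgroup (GL (Fin n) k)) : Type _ := Additive (charGroup H)

/-- The value `χ(h)` of a character. -/
def charEval {H : Subgroup (GL (Fin n) k)} (χ : CharLattice H) (h : H) : kˣ :=
  (χ.toMul : H →* kˣ) h

/-- The coordinate ring `k[t, t⁻¹]` of `𝔾_m`, as an algebra of functions on `k^×`. -/
def gmRing (k : Type*) [Field k] : Subalgebra k (kˣ → k) :=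
  Algebra.adjoin k {fun t : kˣ => (t : k), fun t : kˣ => ((t⁻¹ : kˣ) : k)}

/-- The coordinate ring `k[x]` of `𝔾_a`, as an algebra of functions on `k`. -/
def gaRing (k : Type*) [Field k] : Subalgebra k (k → k) :=
  Algebra.adjoin k {fun x => x}

/-- The coordinate ring of `SL_2`, as an algebra of functions. -/
def sl2Ring (k : Type*) [Field k] : Subalgebra k (SL(2, k) → k) :=
  Algebra.adjoin k {f | ∃ i j, f = fun g : SL(2, k) => (g : Matrix (Fin 2) (Fin 2) k) i j}

end AlgebraicGroups

/-! ### Groups over a finite field -/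

section FiniteField

variable (Fq : Type*) [Field Fq] [Fintype Fq]

/-- The `q`-power Frobenius `σ ∈ Gal(k/𝔽_q)`. -/
abbrev frob (k : Type*) [Field k] [Algebra Fq k] [Algebra.IsAlgebraic Fq k] : k ≃+* k :=
  (FiniteField.frobeniusAlgEquivOfAlgebraic Fq k).toRingEquiv

variable {k : Type*} [Field k] {n : ℕ}

/-- The action on `GL_n(k)` of an automorphism of the field `k`, entrywise. -/
abbrev glMap (τ : k ≃+* k) : GL (Fin n) k →* GL (Fin n) k :=
  Matrix.GeneralLinearGroup.map (τ : k →+* k)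

/-- A closed subgroup of `GL_n(k)`, for `k` an algebraic closure of `𝔽_q`, is defined over `𝔽_q`
if it is stable under the Galois group `Gal(k/𝔽_q)`, which is topologically generated by the
`q`-power Frobenius `σ` (Galois descent; `𝔽_q` is perfect). -/
def IsDefinedOver [Algebra Fq k] [Algebra.IsAlgebraic Fq k]
    (H : Subgroup (GL (Fin n) k)) : Prop :=
  H.map (glMap (frob Fq k)) = H

/-- A Borel pair `(B, T)` of `G` defined over `𝔽_q`. -/
structure BorelPair [Algebra Fq k] [Algebra.IsAlgebraic Fq k]
    (G : Subgroup (GL (Fin n) k)) where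
  /-- the Borel subgroup -/
  B : Subgroup (GL (Fin n) k)
  /-- the maximal torus -/
  T : Subgroup (GL (Fin n) k)
  isBorel : IsBorel G B
  isMaximalTorus : IsMaximalTorus G T
  T_le_B : T ≤ B
  B_defined : IsDefinedOver Fq B
  T_defined : IsDefinedOver Fq T

end FiniteField

section Torus

variable {k : Type*} [Field k] {n : ℕ}

lemma IsTorus.mul_comm {T : Subgroup (GL (Fin n) k)} (hT : IsTorus T) (a b : T) :
    a * b = b * a := by
  obtain ⟨x, hx⟩ := hT.diagonalizable
  have key : ∀ s t : T, x * (s : GL (Fin n) k) * x⁻¹ * (x * (t : GL (Fin n) k) * x⁻¹) =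
      x * (t : GL (Fin n) k) * x⁻¹ * (x * (s : GL (Fin n) k) * x⁻¹) := by
    intro s t
    apply Units.ext
    have h1 := (hx s s.2).diagonal_diag
    have h2 := (hx t t.2).diagonal_diag
    rw [Units.val_mul, Units.val_mul (x * (t : GL (Fin n) k) * x⁻¹), ← h1, ← h2,
      Matrix.diagonal_mul_diagonal, Matrix.diagonal_mul_diagonal]
    congr 1
    funext i
    exact _root_.mul_comm _ _
  have := key a b
  have h3 : x * ((a : GL (Fin n) k) * b) * x⁻¹ = x * ((b : GL (Fin n) k) * a) * x⁻¹ := by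
    calc _ = x * (a : GL (Fin n) k) * x⁻¹ * (x * (b : GL (Fin n) k) * x⁻¹) := by group
      _ = _ := this
      _ = _ := by group
  exact Subtype.ext (mul_left_cancel (mul_right_cancel h3))

end Torus

section Cochar

variable {Fq : Type*} [Field Fq] [Fintype Fq] {k : Type*} [Field k] [Algebra Fq k]
  [Algebra.IsAlgebraic Fq k] {n : ℕ} {G : Subgroup (GL (Fin n) k)}

instance (D : BorelPair Fq G) : CommGroup D.T :=
  { Subgroup.toGroup D.T with mul_comm := D.isMaximalTorus.isTorus.mul_comm }

/-- The algebraic cocharacters `𝔾_m → T`: those homomorphisms `λ` for which all matrix entries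
of `λ(t)` and of `λ(t)⁻¹` are Laurent polynomials in `t`. -/
def cocharGroup (D : BorelPair Fq G) : Subgroup (kˣ →* D.T) where
  carrier := {c | (∀ i j, (fun t => ((c t : GL (Fin n) k) : Matrix (Fin n) (Fin n) k) i j) ∈
      gmRing k) ∧
    (∀ i j, (fun t => (((c t)⁻¹ : D.T) : GL (Fin n) k).val i j) ∈ gmRing k)}
  one_mem' := by
    constructor <;> intro i j <;>
    · simp only [MonoidHom.one_apply, inv_one, OneMemClass.coe_one, Units.val_one]
      exact (gmRing k).algebraMap_mem ((1 : Matrix (Fin n) (Fin n) k) i j)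
  mul_mem' := by
    rintro c d ⟨h1, h2⟩ ⟨h3, h4⟩
    constructor
    · intro i j
      have : (fun t => (((c * d) t : D.T) : GL (Fin n) k).val i j) =
          ∑ l, (fun t => ((c t : GL (Fin n) k).val i l)) *
            (fun t => ((d t : GL (Fin n) k).val l j)) := by
        funext t
        simp [Matrix.mul_apply, Finset.sum_apply]
      rw [this]
      exact sum_mem fun l _ => mul_mem (h1 i l) (h3 l j)
    · intro i j
      have : (fun t => ((((c * d) t)⁻¹ : D.T) : GL (Fin n) k).val i j) =
          ∑ l, (fun t => (((c t)⁻¹ : D.T) : GL (Fin n) k).val i l) *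
            (fun t => (((d t)⁻¹ : D.T) : GL (Fin n) k).val l j) := by
        funext t
        rw [MonoidHom.mul_apply, mul_inv, Subgroup.coe_mul, Units.val_mul, Matrix.mul_apply,
          Finset.sum_apply]
        rfl
      rw [this]
      exact sum_mem fun l _ => mul_mem (h2 i l) (h4 l j)
  inv_mem' := by
    rintro c ⟨h1, h2⟩
    refine ⟨fun i j => h2 i j, fun i j => ?_⟩
    simpa only [MonoidHom.inv_apply, inv_inv] using h1 i j

/-- The cocharacter lattice `X_*(T)`, written additively. -/
abbrev CocharLattice (D : BorelPair Fq G) : Type _ := Additive (cocharGroup D)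

/-- The value `λ(t)` of a cocharacter. -/
def cocharEval {D : BorelPair Fq G} (c : CocharLattice D) (t : kˣ) : D.T :=
  (c.toMul : kˣ →* D.T) t

/-! ### Roots, coroots, simple roots -/

/-- `u : 𝔾_a → G` is a root homomorphism for the character `α` of `T`: an isomorphism of `𝔾_a`
onto a closed subgroup `U_α` of `G` (the last field says that the inverse is regular) such that
`t u(x) t⁻¹ = u(α(t) x)`. -/
structure IsRootHom (D : BorelPair Fq G) (α : CharLattice D.T) (u : k → GL (Fin n) k) :
    Prop where
  mem : ∀ x, u x ∈ G
  map_add : ∀ x y, u (x + y) = u x * u y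
  regular : ∀ i j, (fun x => (u x : Matrix (Fin n) (Fin n) k) i j) ∈ gaRing k
  conj : ∀ (t : D.T) (x : k), (t : GL (Fin n) k) * u x * (t : GL (Fin n) k)⁻¹ =
    u ((charEval α t : k) * x)
  closed_immersion : ∃ F ∈ glRing k n, ∀ x, F (u x) = x

/-- The upper unipotent element of `SL_2`. -/
def sl2Upper (x : k) : SL(2, k) := ⟨!![1, x; 0, 1], by simp⟩

/-- The lower unipotent element of `SL_2`. -/
def sl2Lower (x : k) : SL(2, k) := ⟨!![1, 0; x, 1], by simp⟩

/-- The diagonal element of `SL_2`. -/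
def sl2Diag (t : kˣ) : SL(2, k) := ⟨!![(t : k), 0; 0, ((t⁻¹ : kˣ) : k)], by simp⟩

/-- `α` is a root of `(G, T)` with coroot `c`: there is a homomorphism of algebraic groups
`φ : SL_2 → G` which restricts to root homomorphisms for `α` and `-α` on the upper and lower
unipotent matrices, and to `c` on the diagonal matrices. -/
def IsRootCorootPair (D : BorelPair Fq G) (α : CharLattice D.T) (c : CocharLattice D) : Prop :=
  ∃ φ : SL(2, k) →* GL (Fin n) k,
    (∀ g, φ g ∈ G) ∧
    (∀ i j, (fun g => (φ g : Matrix (Fin n) (Fin n) k) i j) ∈ sl2Ring k) ∧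
    IsRootHom D α (fun x => φ (sl2Upper x)) ∧
    IsRootHom D (-α) (fun x => φ (sl2Lower x)) ∧
    ∀ t : kˣ, φ (sl2Diag t) = (cocharEval c t : GL (Fin n) k)

/-- `R` is the root datum `(X^*(T), Φ, X_*(T), Φ^∨)` of `(G, T)`: the pairing is the natural one
and the pairs (root, coroot) are those of `(G, T)`. -/
structure IsRootDatumOf {ι : Type*} (D : BorelPair Fq G)
    (R : RootDatum ι (CharLattice D.T) (CocharLattice D)) : Prop where
  pairing : ∀ (χ : CharLattice D.T) (c : CocharLattice D) (t : kˣ),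
    charEval χ (cocharEval c t) = t ^ (R.toLinearMap χ c)
  roots : Set.range (fun i => (R.root i, R.coroot i)) =
    {p : CharLattice D.T × CocharLattice D | IsRootCorootPair D p.1 p.2}

variable {ι : Type*} {D : BorelPair Fq G}

/-- The base `b` consists of the simple roots of the system of positive roots given by the Borel
subgroup `B^+` opposite to `B` with respect to `T`: a root `α` is positive (`U_α ⊆ B^+`) if and only
if `U_{-α} ⊆ B`. -/
def IsSimpleSystemOf (R : RootDatum ι (CharLattice D.T) (CocharLattice D)) (b : R.Base) : Prop :=
  ∀ i, b.IsPos i ↔ ∀ u, IsRootHom D (-R.root i) u → ∀ x, u x ∈ D.B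

/-! ### The parabolic subgroup attached to a cocharacter -/

/-- The parabolic subgroup `P = P_-(μ)` of `G` attached to a cocharacter `μ` of `T`: it is
generated by `T` and by the root subgroups `U_α` with `⟨α, μ⟩ ≤ 0`, i.e. those `U_α` for which
`μ(t)⁻¹ u_α(x) μ(t) = u_α(t^{-⟨α, μ⟩} x)` extends to `t = 0`. -/
def parabolic (R : RootDatum ι (CharLattice D.T) (CocharLattice D)) (μ : CocharLattice D) :
    Subgroup (GL (Fin n) k) :=
  Subgroup.closure ((D.T : Set (GL (Fin n) k)) ∪
    {g | ∃ i u x, R.toLinearMap (R.root i) μ ≤ 0 ∧ IsRootHom D (R.root i) u ∧ g = u x})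

/-- The (indices of the) roots `Φ_L` of the Levi subgroup `L ⊆ P`, the centralizer of `μ`. -/
def leviRoots (R : RootDatum ι (CharLattice D.T) (CocharLattice D)) (μ : CocharLattice D) :
    Set ι :=
  {i | R.toLinearMap (R.root i) μ = 0}

/-- The type `I ⊆ Δ` of `P`: the simple roots of `L`. -/
def parabolicType (R : RootDatum ι (CharLattice D.T) (CocharLattice D)) (b : R.Base)
    (μ : CocharLattice D) : Set ι :=
  {i | i ∈ b.support ∧ i ∈ leviRoots R μ}

end Cochar

/-! ### Weyl group elements -/

section Weyl

variable {ι X Y : Type*} [AddCommGroup X] [AddCommGroup Y]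

/-- The subgroup `W_K` of the Weyl group generated by the reflections in the roots of `K`. -/
def reflectionSubgroup (R : RootDatum ι X Y) (K : Set ι) : Subgroup (X ≃ₗ[ℤ] X) :=
  Subgroup.closure (R.reflection '' K)

/-- The length of an element of the Weyl group with respect to the simple reflections. -/
def weylLength (R : RootDatum ι X Y) (b : R.Base) (w : X ≃ₗ[ℤ] X) : ℕ :=
  sInf {m | ∃ l : List ι, (∀ i ∈ l, i ∈ b.support) ∧ (l.map R.reflection).prod = w ∧
    l.length = m}

/-- `w` is the longest element `w_{0,K}` of `W_K`. -/
def IsLongestElement (R : RootDatum ι X Y) (b : R.Base) (K : Set ι) (w : X ≃ₗ[ℤ] X) : Prop :=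
  w ∈ reflectionSubgroup R K ∧
    ∀ w' ∈ reflectionSubgroup R K, weylLength R b w' ≤ weylLength R b w

end Weyl

/-! ### The Frobenius action on characters -/

section Frobenius

variable {k : Type*} [Field k] {n : ℕ}

lemma glRing_twist (τ : k ≃+* k) {F : GL (Fin n) k → k} (hF : F ∈ glRing k n) :
    (fun g => τ (F (glMap τ.symm g))) ∈ glRing k n := by
  induction hF using Algebra.adjoin_induction with
  | mem f hf =>
    rcases hf with ⟨i, j, rfl⟩ | hf
    · refine Algebra.subset_adjoin (Or.inl ⟨i, j, ?_⟩)
      funext g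
      simp
    · rw [Set.mem_singleton_iff] at hf
      subst hf
      refine Algebra.subset_adjoin (Or.inr ?_)
      rw [Set.mem_singleton_iff]
      funext g
      have h : ((glMap τ.symm g : GL (Fin n) k) : Matrix (Fin n) (Fin n) k).det =
          τ.symm (g : Matrix (Fin n) (Fin n) k).det := by
        rw [RingEquiv.map_det]
        rfl
      simp only [h, map_inv₀, RingEquiv.apply_symm_apply]
  | algebraMap r => exact (glRing k n).algebraMap_mem (τ r)
  | add f g _ _ hf hg => simpa using! add_mem hf hg
  | mul f g _ _ hf hg => simpa using! mul_mem hf hg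

lemma glMap_symm_mem {H : Subgroup (GL (Fin n) k)} {τ : k ≃+* k} (hH : H.map (glMap τ) = H)
    {g : GL (Fin n) k} (hg : g ∈ H) : glMap τ.symm g ∈ H := by
  rw [← hH] at hg
  obtain ⟨h, hh, rfl⟩ := hg
  have : glMap τ.symm (glMap τ h) = h := by
    ext i j
    simp
  rwa [this]

/-- The natural Galois action on characters: for a subgroup `H` stable under the automorphism `τ`,
the character `τ · χ` is `h ↦ τ(χ(τ⁻¹(h)))`. -/
def twistHom (τ : k ≃+* k) {H : Subgroup (GL (Fin n) k)} (hH : H.map (glMap τ) = H)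
    (χ : H →* kˣ) : H →* kˣ where
  toFun h := Units.map (τ : k →* k) (χ ⟨glMap τ.symm h, glMap_symm_mem hH h.2⟩)
  map_one' := by
    have : (⟨glMap τ.symm ((1 : H) : GL (Fin n) k), glMap_symm_mem hH (1 : H).2⟩ : H) = 1 :=
      Subtype.ext (map_one _)
    rw [this, map_one, map_one]
  map_mul' g h := by
    have : (⟨glMap τ.symm ((g * h : H) : GL (Fin n) k), glMap_symm_mem hH (g * h).2⟩ : H) =
        ⟨glMap τ.symm g, glMap_symm_mem hH g.2⟩ * ⟨glMap τ.symm h, glMap_symm_mem hH h.2⟩ :=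
      Subtype.ext (map_mul _ _ _)
    rw [this, map_mul, map_mul]

lemma twistHom_mem (τ : k ≃+* k) {H : Subgroup (GL (Fin n) k)} (hH : H.map (glMap τ) = H)
    {χ : H →* kˣ} (hχ : χ ∈ charGroup H) : twistHom τ hH χ ∈ charGroup H := by
  obtain ⟨⟨F, hF, hF'⟩, ⟨K, hK, hK'⟩⟩ := hχ
  refine ⟨⟨_, glRing_twist τ hF, fun h => ?_⟩, ⟨_, glRing_twist τ hK, fun h => ?_⟩⟩
  · change τ (χ _ : k) = _
    exact congrArg τ (hF' ⟨glMap τ.symm h, glMap_symm_mem hH h.2⟩)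
  · change ((Units.map (τ : k →* k) (χ _))⁻¹ : kˣ).val = _
    rw [← map_inv]
    exact congrArg τ (hK' ⟨glMap τ.symm h, glMap_symm_mem hH h.2⟩)

lemma map_glMap_symm {H : Subgroup (GL (Fin n) k)} {τ : k ≃+* k} (hH : H.map (glMap τ) = H) :
    H.map (glMap τ.symm) = H := by
  apply le_antisymm
  · rintro _ ⟨g, hg, rfl⟩
    exact glMap_symm_mem hH hg
  · intro g hg
    refine ⟨glMap τ g, ?_, ?_⟩
    · have : glMap τ g ∈ H.map (glMap τ) := ⟨g, hg, rfl⟩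
      rwa [hH] at this
    · ext i j
      simp

/-- The automorphism of the character lattice of `H` induced by `τ`. -/
def twist (τ : k ≃+* k) {H : Subgroup (GL (Fin n) k)} (hH : H.map (glMap τ) = H) :
    CharLattice H ≃+ CharLattice H where
  toFun χ := Additive.ofMul ⟨twistHom τ hH χ.toMul, twistHom_mem τ hH χ.toMul.2⟩
  invFun χ := Additive.ofMul ⟨twistHom τ.symm (map_glMap_symm hH) χ.toMul,
    twistHom_mem τ.symm (map_glMap_symm hH) χ.toMul.2⟩
  left_inv χ := by
    apply Additive.toMul.injective
    apply Subtype.ext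
    ext h
    change τ.symm (τ ((χ.toMul : H →* kˣ) _ : k)) = _
    rw [RingEquiv.symm_apply_apply]
    congr 3
    ext i j
    simp
  right_inv χ := by
    apply Additive.toMul.injective
    apply Subtype.ext
    ext h
    change τ (τ.symm ((χ.toMul : H →* kˣ) _ : k)) = _
    rw [RingEquiv.apply_symm_apply]
    congr 3
    ext i j
    simp
  map_add' χ ψ := by
    apply Additive.toMul.injective
    apply Subtype.ext
    ext h
    change τ (((χ.toMul : H →* kˣ) _ : k) * ((ψ.toMul : H →* kˣ) _ : k)) = _
    rw [map_mul]
    rfl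

variable {Fq : Type*} [Field Fq] [Fintype Fq] [Algebra Fq k] [Algebra.IsAlgebraic Fq k]
  {G : Subgroup (GL (Fin n) k)}

/-- The action of the `q`-power Frobenius `σ` on `X^*(T)`. -/
def frobChar (D : BorelPair Fq G) : CharLattice D.T ≃+ CharLattice D.T :=
  twist (frob Fq k) D.T_defined

end Frobenius

/-! ### Cones -/

section Cones

variable {ι X Y : Type*} [AddCommGroup X] [AddCommGroup Y]

/-- The `K`-dominant characters `X^*_{+,K}(T)`; for `K = Δ` these are the dominant characters. -/
def dominant (R : RootDatum ι X Y) (K : Set ι) : Set X :=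
  {χ | ∀ i ∈ K, 0 ≤ R.toLinearMap χ (R.coroot i)}

/-- The saturation of a subset `C` of a lattice. -/
def saturation (C : Set X) : Set X :=
  {χ | ∃ N : ℕ, 1 ≤ N ∧ N • χ ∈ C}

/-- The inclusion of a lattice `X` into `X_ℝ = ℝ ⊗ X`. -/
def toReal (χ : X) : ℝ ⊗[ℤ] X := (1 : ℝ) ⊗ₜ[ℤ] χ

/-- The real cone `C_{ℝ≥0} ⊆ X_ℝ` of combinations of elements of `C` with coefficients
in `ℝ≥0`. -/
def realCone (C : Set X) : Set (ℝ ⊗[ℤ] X) :=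
  (Submodule.span ℝ≥0 (toReal '' C) : Set (ℝ ⊗[ℤ] X))

/-- `C ⊆ Z` is a neighborhood of the subset `S ⊆ Z` in `Z`, where `Z ⊆ X_ℝ` has the subspace
topology of the usual topology of the finite dimensional real vector space `X_ℝ` (the finest
vector space topology). -/
def IsNeighborhoodIn (Z C S : Set (ℝ ⊗[ℤ] X)) : Prop :=
  C ⊆ Z ∧ S ⊆ Z ∧ ∀ x ∈ S, C ∈ @nhdsWithin _ (moduleTopology ℝ (ℝ ⊗[ℤ] X)) x Z

end Cones

section ZipCones

variable {Fq : Type*} [Field Fq] [Fintype Fq] {k : Type*} [Field k] [Algebra Fq k]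
  [Algebra.IsAlgebraic Fq k] {n : ℕ} {G : Subgroup (GL (Fin n) k)} {D : BorelPair Fq G}
  {ι : Type*}

/-- The map `h_𝒵 : λ ↦ λ - q w_{0,I}(σ⁻¹ λ)`. -/
def hMap (D : BorelPair Fq G) (w : CharLattice D.T ≃ₗ[ℤ] CharLattice D.T)
    (χ : CharLattice D.T) : CharLattice D.T :=
  χ - Fintype.card Fq • w ((frobChar D).symm χ)

/-- The partial Hasse invariant cone `C_pHa = h_𝒵(X^*_+(T))`. -/
def pHaCone (R : RootDatum ι (CharLattice D.T) (CocharLattice D)) (b : R.Base)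
    (w : CharLattice D.T ≃ₗ[ℤ] CharLattice D.T) : Set (CharLattice D.T) :=
  hMap D w '' dominant R (b.support : Set ι)

/-- The Griffiths–Schmid cone `𝒞_GS`. -/
def gsCone (R : RootDatum ι (CharLattice D.T) (CocharLattice D)) (b : R.Base)
    (μ : CocharLattice D) : Set (CharLattice D.T) :=
  {χ | (∀ i ∈ parabolicType R b μ, 0 ≤ R.toLinearMap χ (R.coroot i)) ∧
    ∀ i, b.IsPos i → i ∉ leviRoots R μ → R.toLinearMap χ (R.coroot i) ≤ 0}

/-- `X^*_-(L)_reg`: the characters of `L`, viewed as the characters `λ` of `T` orthogonal to the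
coroots of `I`, such that `⟨λ, α^∨⟩ < 0` for all `α ∈ Δ ∖ I`. -/
def leviRegular (R : RootDatum ι (CharLattice D.T) (CocharLattice D)) (b : R.Base)
    (μ : CocharLattice D) : Set (CharLattice D.T) :=
  {χ | (∀ i ∈ parabolicType R b μ, R.toLinearMap χ (R.coroot i) = 0) ∧
    ∀ i ∈ b.support, i ∉ parabolicType R b μ → R.toLinearMap χ (R.coroot i) < 0}

end ZipCones

end

end HasseType

/-!
The theorem reduces to a statement about the root datum with its Frobenius action, which is proved
by comparing the signs of weights on coroots.

Put `A = w_{0,I} σ⁻¹` and `h = 1 - qA`. The longest element `w_{0,I}` maps `I` to `-I`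
(`IsLongestElement.exists_neg_root`, from the exchange condition) and `σ` permutes `Δ`
(`IsRootAut.mem_support`), so there is an injection `τ : I → Δ`, namely `-σ w_{0,I}⁻¹`, with
`⟨hλ, α^∨⟩ = ⟨λ, α^∨⟩ + q ⟨λ, (τα)^∨⟩` for `α ∈ I`. Hence `h` maps dominant weights to `I`-dominant
ones. Condition (iii) says that `τ` is the identity of `I`: this gives `σ = -w_{0,I}` on `I`, hence
`σI = I`, and then `σ` preserves the roots that are nonpositive on `μ`, that is, `P`. The system of
inequalities is isolated in the structure `TwistedSystem`; the map `h` is invertible over `ℚ`, since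
its determinant is `1` modulo `q`.

* Let `τ = id`. If `hλ` lies in the Griffiths–Schmid cone, then `λ` is dominant
  (`TwistedSystem.rcoroot_nonneg_of_rh`). On `I` this holds because `h` multiplies the values by
  `1 + q`. The contragredient of `A` permutes the positive coroots outside `Φ_L`, and the
  inequality `⟨λ, β^∨⟩ ≤ q ⟨λ, γ^∨⟩`, for `γ` the image of `β` under this permutation, shows that
  the smallest of the values of `λ` on them is nonnegative. This is (ii). It also gives (i), since
  the elements of `X^*_-(L)_reg` satisfy the inequalities outside `Φ_L` strictly
  (`pairing_coroot_neg`).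
* Conversely, both (i) and (ii) imply that each `I`-dominant weight, translated far enough in a
  direction of `X^*_-(L)_reg`, lies in the Hasse cone (`TwistedSystem.AbsorbsDominant`). For weights
  orthogonal to `I`, the equation `0 = ⟨λ, α^∨⟩ + q ⟨λ, (τα)^∨⟩` with `λ` dominant shows that `h⁻¹`
  maps the orthogonal complement of `I` into that of `I ∪ τI`; comparing dimensions, `τI = I`
  (`TwistedSystem.τ_mem_I`). Applied to the fundamental weight of `α ∈ I`, the same equation then
  forces `τα = α` (`TwistedSystem.τ_eq_self`).

The facts on algebraic groups that enter are the following. The lattice `X^*(T)` is finitely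
generated, by the linear independence of characters (`IsTorus.finite_charLattice`). Frobenius acts
on the roots and coroots and preserves positivity (`exists_isRootAut_twist`, `isPos_twist_iff`).
Every element `g` of `P` has the property that `μ(t)⁻¹ g μ(t)` extends to `t = 0`, so a root group
contained in `P` has a root that is nonpositive on `μ` (`pairing_nonpos_of_mem_parabolic`); since
`B ⊆ P`, the positive roots are nonnegative on `μ`.
-/

namespace HasseType

/-! ### Real extensions of integral functionals -/

section RealExtension

variable {X : Type*} [AddCommGroup X]

/-- The real functional `ℝ ⊗ X → ℝ` extending an integral functional on `X`. -/
noncomputable def realFunctional (f : X →ₗ[ℤ] ℤ) : ℝ ⊗[ℤ] X →ₗ[ℝ] ℝ :=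
  (TensorProduct.AlgebraTensorModule.rid ℤ ℝ ℝ).toLinearMap ∘ₗ f.baseChange ℝ

@[simp]
lemma realFunctional_tmul (f : X →ₗ[ℤ] ℤ) (r : ℝ) (x : X) :
    realFunctional f (r ⊗ₜ x) = f x * r := by
  simp [realFunctional]

@[simp]
lemma realFunctional_toReal (f : X →ₗ[ℤ] ℤ) (x : X) : realFunctional f (toReal x) = f x := by
  simp [toReal]

lemma toReal_add (x y : X) : toReal (x + y) = toReal x + toReal y :=
  TensorProduct.tmul_add _ _ _

lemma toReal_nsmul (m : ℕ) (x : X) : toReal (m • x) = (m : ℝ) • toReal x := by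
  rw [toReal, toReal, TensorProduct.tmul_smul, Nat.cast_smul_eq_nsmul]

lemma toReal_zsmul (m : ℤ) (x : X) : toReal (m • x) = (m : ℝ) • toReal x := by
  rw [toReal, toReal, TensorProduct.tmul_smul, Int.cast_smul_eq_zsmul]

lemma tmul_eq_smul_toReal (r : ℝ) (x : X) : r ⊗ₜ[ℤ] x = r • toReal x := by
  simp [toReal, TensorProduct.smul_tmul']

lemma toReal_mem_realCone {C : Set X} {x : X} (hx : x ∈ C) : toReal x ∈ realCone C :=
  Submodule.subset_span ⟨x, hx, rfl⟩

lemma add_mem_realCone {C : Set X} {x y : ℝ ⊗[ℤ] X} (hx : x ∈ realCone C) (hy : y ∈ realCone C) :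
    x + y ∈ realCone C :=
  (Submodule.span ℝ≥0 (toReal '' C)).add_mem hx hy

lemma smul_mem_realCone {C : Set X} {x : ℝ ⊗[ℤ] X} {r : ℝ} (hr : 0 ≤ r) (hx : x ∈ realCone C) :
    r • x ∈ realCone C :=
  (Submodule.span ℝ≥0 (toReal '' C)).smul_mem ⟨r, hr⟩ hx

lemma zero_mem_realCone {C : Set X} : (0 : ℝ ⊗[ℤ] X) ∈ realCone C :=
  (Submodule.span ℝ≥0 (toReal '' C)).zero_mem

lemma realCone_induction {C : Set X} {p : ℝ ⊗[ℤ] X → Prop} (mem : ∀ x ∈ C, p (toReal x))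
    (zero : p 0) (add : ∀ x y, p x → p y → p (x + y)) (smul : ∀ (r : ℝ) x, 0 ≤ r → p x → p (r • x))
    {x : ℝ ⊗[ℤ] X} (hx : x ∈ realCone C) : p x := by
  refine Submodule.span_induction ?_ zero (fun x y _ _ => add x y)
    (fun r x _ h => smul r x r.2 h) hx
  rintro _ ⟨x, hx, rfl⟩
  exact mem x hx

lemma realCone_mono {C D : Set X} (h : ∀ x ∈ C, toReal x ∈ realCone D) :
    realCone C ⊆ realCone D := fun _ hx =>
  realCone_induction (p := fun x => x ∈ realCone D) h zero_mem_realCone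
    (fun _ _ => add_mem_realCone) (fun _ _ => smul_mem_realCone) hx

lemma toReal_mem_realCone_of_mem_saturation {C : Set X} {x : X} (hx : x ∈ saturation C) :
    toReal x ∈ realCone C := by
  obtain ⟨m, hm, hx⟩ := hx
  have h := toReal_mem_realCone hx
  rw [toReal_nsmul] at h
  have hm' : (m : ℝ) ≠ 0 := by positivity
  simpa [smul_smul, hm'] using smul_mem_realCone (r := (m : ℝ)⁻¹) (by positivity) h

/-- `1 - qA` is invertible modulo `q`, hence of nonzero determinant. -/
lemma det_one_sub_smul_ne_zero {m : Type*} [Fintype m] [DecidableEq m] (q : ℕ) (hq : 2 ≤ q)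
    (M : Matrix m m ℤ) : (1 - q • M).det ≠ 0 := by
  intro h
  have : Fact (1 < q) := ⟨hq⟩
  have h1 := congrArg (Int.castRingHom (ZMod q)) h
  rw [RingHom.map_det, map_sub, map_one, map_nsmul, nsmul_eq_mul, ← map_natCast
    (algebraMap (ZMod q) (Matrix m m (ZMod q))), ZMod.natCast_self, map_zero, zero_mul, sub_zero,
    Matrix.det_one, map_zero] at h1
  exact one_ne_zero h1

lemma exists_nsmul_mem_range_one_sub [Module.Finite ℤ X] [Module.Free ℤ X] (q : ℕ) (hq : 2 ≤ q)
    (A : X →ₗ[ℤ] X) : ∃ m : ℕ, 1 ≤ m ∧ ∀ x, ∃ y, y - q • A y = m • x := by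
  classical
  let e := Module.Free.chooseBasis ℤ X
  set M := LinearMap.toMatrix e e A
  set H := 1 - q • M with hH
  have hd : H.det ≠ 0 := det_one_sub_smul_ne_zero q hq M
  refine ⟨H.det.natAbs, Int.natAbs_pos.mpr hd, fun x => ⟨H.det.sign • Matrix.toLin e e H.adjugate x,
    ?_⟩⟩
  have h1 : Matrix.toLin e e H = 1 - q • A := by
    rw [hH, map_sub, map_nsmul, Matrix.toLin_one, Matrix.toLin_toMatrix]; rfl
  have h2 : ∀ y, y - q • A y = Matrix.toLin e e H y := fun y => by rw [h1]; rfl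
  have h3 : Matrix.toLin e e H (Matrix.toLin e e H.adjugate x) = H.det • x := by
    rw [← Matrix.toLin_mul_apply, Matrix.mul_adjugate, map_smul, Matrix.toLin_one]; rfl
  rw [h2, map_smul, h3, smul_smul, Int.sign_mul_self_eq_natAbs, natCast_zsmul]

end RealExtension

/-! ### Cones of a twisted system of coroots -/

/-- The part of a root datum with Frobenius that controls the partial Hasse invariant cone: a
lattice `X` with functionals `coroot i`, simple indices `Δ`, a subset `I ⊆ Δ`, the set `S` of
positive indices outside the Levi part, fundamental weights up to a factor `N`, and an endomorphism
`A` of `X` which on the coroots of `I` acts by `-τ` for an injection `τ : I → Δ`. -/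
structure TwistedSystem (ι X : Type*) [AddCommGroup X] where
  /-- the coroots, as functionals -/
  coroot : ι → X →ₗ[ℤ] ℤ
  /-- the simple indices -/
  Δ : Finset ι
  /-- the simple indices of the Levi part -/
  I : Set ι
  /-- the positive indices outside the Levi part -/
  S : Set ι
  I_subset : I ⊆ Δ
  mem_S : ∀ i ∈ Δ, i ∉ I → i ∈ S
  /-- the common multiple of the fundamental weights -/
  N : ℕ
  N_pos : 0 < N
  /-- the fundamental weights, multiplied by `N` -/
  weight : ι → X
  coroot_weight_self : ∀ i ∈ Δ, coroot i (weight i) = N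
  coroot_weight_of_ne : ∀ i ∈ Δ, ∀ j ∈ Δ, i ≠ j → coroot i (weight j) = 0
  /-- the integer `q` -/
  q : ℕ
  two_le_q : 2 ≤ q
  /-- the twisting endomorphism -/
  A : X →ₗ[ℤ] X
  /-- the map on indices induced by `-A` -/
  τ : ι → ι
  τ_mem : ∀ i ∈ I, τ i ∈ Δ
  τ_injOn : Set.InjOn τ I
  coroot_A : ∀ i ∈ I, ∀ x, coroot i (A x) = -coroot (τ i) x
  coroot_neg_of_regular : ∀ x, (∀ i ∈ I, coroot i x = 0) → (∀ i ∈ Δ, i ∉ I → coroot i x < 0) →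
    ∀ s ∈ S, coroot s x < 0
  exists_coroot_A : (∀ i ∈ I, τ i = i) → ∀ s ∈ S, ∃ s' ∈ S, ∀ x, coroot s' (A x) = coroot s x

namespace TwistedSystem

variable {ι X : Type*} [AddCommGroup X] (E : TwistedSystem ι X)

/-- The weights that are dominant with respect to the indices in `K`. -/
def dom (K : Set ι) : Set X := {x | ∀ i ∈ K, 0 ≤ E.coroot i x}

/-- The weights that vanish on `I` and are negative on `Δ ∖ I`. -/
def reg : Set X := {x | (∀ i ∈ E.I, E.coroot i x = 0) ∧ ∀ i ∈ E.Δ, i ∉ E.I → E.coroot i x < 0}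

/-- The weights that are nonnegative on `I` and nonpositive on `S`. -/
def gs : Set X := {x | (∀ i ∈ E.I, 0 ≤ E.coroot i x) ∧ ∀ s ∈ E.S, E.coroot s x ≤ 0}

/-- The map `1 - qA`. -/
def h : X →ₗ[ℤ] X := LinearMap.id - E.q • E.A

lemma h_apply (x : X) : E.h x = x - E.q • E.A x := rfl

/-- The image of the dominant weights under `1 - qA`. -/
def hasse : Set X := E.h '' E.dom E.Δ

/-- The real extension of a coroot. -/
noncomputable def rcoroot (i : ι) : ℝ ⊗[ℤ] X →ₗ[ℝ] ℝ := realFunctional (E.coroot i)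

/-- The real extension of `1 - qA`. -/
noncomputable def rh : ℝ ⊗[ℤ] X →ₗ[ℝ] ℝ ⊗[ℤ] X := E.h.baseChange ℝ

lemma rcoroot_toReal (i : ι) (x : X) : E.rcoroot i (toReal x) = E.coroot i x :=
  realFunctional_toReal _ _

lemma rh_toReal (x : X) : E.rh (toReal x) = toReal (E.h x) := by
  simp [rh, toReal]

/-- A linear expression for a coroot of `(1 - qA)x` in terms of `x` persists over `ℝ`. -/
lemma rcoroot_rh_eq {i j : ι} {a b : ℤ} (hx : ∀ x, E.coroot i (E.h x) =
    a * E.coroot i x + b * E.coroot j x) (y : ℝ ⊗[ℤ] X) :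
    E.rcoroot i (E.rh y) = a * E.rcoroot i y + b * E.rcoroot j y := by
  induction y with
  | zero => simp
  | add y z hy hz => rw [map_add, map_add, map_add, map_add, hy, hz]; ring
  | tmul r x =>
    rw [tmul_eq_smul_toReal, map_smul, map_smul, map_smul, map_smul, rh_toReal, rcoroot_toReal, hx,
      rcoroot_toReal, rcoroot_toReal]
    push_cast [smul_eq_mul]
    ring

lemma rcoroot_rh_of_mem_I {i : ι} (hi : i ∈ E.I) (y : ℝ ⊗[ℤ] X) :
    E.rcoroot i (E.rh y) = E.rcoroot i y + E.q * E.rcoroot (E.τ i) y := by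
  have := E.rcoroot_rh_eq (i := i) (j := E.τ i) (a := 1) (b := E.q) (fun x => by
    rw [h_apply, map_sub, map_nsmul, E.coroot_A i hi, nsmul_eq_mul]; ring) y
  simpa using this

lemma exists_h_eq_nsmul [Module.Finite ℤ X] [Module.Free ℤ X] :
    ∃ m : ℕ, 1 ≤ m ∧ ∀ x, ∃ y, E.h y = m • x :=
  exists_nsmul_mem_range_one_sub E.q E.two_le_q E.A

lemma rh_surjective [Module.Finite ℤ X] [Module.Free ℤ X] : Function.Surjective E.rh := by
  obtain ⟨m, hm, hy⟩ := E.exists_h_eq_nsmul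
  have hm' : (m : ℝ) ≠ 0 := by positivity
  intro z
  induction z with
  | zero => exact ⟨0, map_zero _⟩
  | add y z hy hz =>
    obtain ⟨a, rfl⟩ := hy
    obtain ⟨b, rfl⟩ := hz
    exact ⟨a + b, map_add _ _ _⟩
  | tmul r x =>
    obtain ⟨y, hy⟩ := hy x
    refine ⟨(r * (m : ℝ)⁻¹) • toReal y, ?_⟩
    rw [map_smul, rh_toReal, hy, toReal_nsmul, smul_smul, tmul_eq_smul_toReal]
    congr 1
    field_simp

/-- Every real weight is, up to the factor `N`, the sum of its component along the fundamental
weights and of a combination of integral weights killed by all simple coroots. -/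
lemma exists_smul_eq_add_sum_weight (y : ℝ ⊗[ℤ] X) :
    ∃ z ∈ Submodule.span ℝ (toReal '' {v | ∀ i ∈ E.Δ, E.coroot i v = 0}),
      (E.N : ℝ) • y = z + ∑ i ∈ E.Δ, E.rcoroot i y • toReal (E.weight i) := by
  induction y with
  | zero => exact ⟨0, Submodule.zero_mem _, by simp⟩
  | add y y' h1 h2 =>
    obtain ⟨z, hz, h1⟩ := h1
    obtain ⟨z', hz', h2⟩ := h2
    refine ⟨z + z', Submodule.add_mem _ hz hz', ?_⟩
    simp only [smul_add, h1, h2, map_add, add_smul, Finset.sum_add_distrib]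
    abel
  | tmul r x =>
    set x' := E.N • x - ∑ i ∈ E.Δ, E.coroot i x • E.weight i with hx'
    have h0 : ∀ i ∈ E.Δ, E.coroot i x' = 0 := by
      intro i hi
      rw [hx', map_sub, map_nsmul, map_sum, Finset.sum_eq_single i]
      · rw [map_zsmul, E.coroot_weight_self i hi]; simp [mul_comm]
      · intro j hj hji
        rw [map_zsmul, E.coroot_weight_of_ne i hi j hj hji.symm, smul_zero]
      · exact fun h => absurd hi h
    refine ⟨r • toReal x', Submodule.smul_mem _ _ (Submodule.subset_span ⟨x', h0, rfl⟩), ?_⟩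
    have h1 : toReal (E.N • x) =
        toReal x' + ∑ i ∈ E.Δ, (E.coroot i x : ℝ) • toReal (E.weight i) := by
      have : E.N • x = x' + ∑ i ∈ E.Δ, E.coroot i x • E.weight i := by rw [hx']; abel
      rw [this, toReal_add]
      congr 1
      simp_rw [← toReal_zsmul]
      exact TensorProduct.tmul_sum _ _ _
    rw [tmul_eq_smul_toReal, smul_comm, ← toReal_nsmul, h1, smul_add, Finset.smul_sum]
    congr 1
    refine Finset.sum_congr rfl fun i _ => ?_
    rw [map_smul, rcoroot_toReal, smul_eq_mul, mul_smul]

/-- The real cone spanned by the integral weights that are nonnegative on the coroots in `K ⊆ Δ`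
contains all real weights with this property. -/
lemma mem_realCone_dom {K : Set ι} (hK : K ⊆ E.Δ) {y : ℝ ⊗[ℤ] X}
    (hy : ∀ i ∈ K, 0 ≤ E.rcoroot i y) : y ∈ realCone (E.dom K) := by
  have smul_mem : ∀ {x : ℝ ⊗[ℤ] X} (r : ℝ), x ∈ realCone (E.dom K) → -x ∈ realCone (E.dom K) →
      r • x ∈ realCone (E.dom K) := by
    intro x r h1 h2
    rcases le_total 0 r with hr | hr
    · exact smul_mem_realCone hr h1
    · rw [← neg_smul_neg]
      exact smul_mem_realCone (neg_nonneg.mpr hr) h2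
  have toReal_neg : ∀ v : X, -toReal v = toReal (-v) := fun v =>
    (TensorProduct.tmul_neg _ _).symm
  have key : ∀ z ∈ Submodule.span ℝ (toReal '' {v | ∀ i ∈ E.Δ, E.coroot i v = 0}),
      z ∈ realCone (E.dom K) ∧ -z ∈ realCone (E.dom K) := by
    intro z hz
    induction hz using Submodule.span_induction with
    | mem z hz =>
      obtain ⟨v, hv, rfl⟩ := hz
      rw [toReal_neg]
      exact ⟨toReal_mem_realCone fun i hi => (hv i (hK hi)).ge,
        toReal_mem_realCone fun i hi => by rw [map_neg, hv i (hK hi), neg_zero]⟩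
    | zero => simpa using zero_mem_realCone
    | add x y _ _ hx hy =>
      rw [neg_add]
      exact ⟨add_mem_realCone hx.1 hy.1, add_mem_realCone hx.2 hy.2⟩
    | smul r x _ hx =>
      rw [← smul_neg]
      exact ⟨smul_mem r hx.1 hx.2, smul_mem r hx.2 (by simpa using hx.1)⟩
  obtain ⟨z, hz, h⟩ := E.exists_smul_eq_add_sum_weight y
  have hN : (E.N : ℝ) ≠ 0 := by exact_mod_cast E.N_pos.ne'
  have h2 : (E.N : ℝ) • y ∈ realCone (E.dom K) := by
    rw [h]
    refine add_mem_realCone (key z hz).1 ?_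
    refine Submodule.sum_mem (Submodule.span ℝ≥0 (toReal '' E.dom K)) fun i hi => ?_
    change _ ∈ realCone (E.dom K)
    have hne : ∀ j ∈ K, j ≠ i → E.coroot j (E.weight i) = 0 := fun j hj hji =>
      E.coroot_weight_of_ne j (hK hj) i hi hji
    by_cases hiK : i ∈ K
    · refine smul_mem_realCone (hy i hiK) (toReal_mem_realCone fun j hj => ?_)
      by_cases hji : j = i
      · rw [hji, E.coroot_weight_self i hi]; positivity
      · rw [hne j hj hji]
    · have h0 : ∀ j ∈ K, E.coroot j (E.weight i) = 0 := fun j hj =>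
        hne j hj (fun h => hiK (h ▸ hj))
      refine smul_mem _ (toReal_mem_realCone fun j hj => (h0 j hj).ge) ?_
      rw [toReal_neg]
      exact toReal_mem_realCone fun j hj => by rw [map_neg, h0 j hj, neg_zero]
  simpa [smul_smul, hN] using smul_mem_realCone (r := (E.N : ℝ)⁻¹) (by positivity) h2

lemma rcoroot_nonneg_of_mem_realCone_dom {K : Set ι} {y : ℝ ⊗[ℤ] X} (hy : y ∈ realCone (E.dom K)) :
    ∀ i ∈ K, 0 ≤ E.rcoroot i y := by
  intro i hi
  refine realCone_induction (p := fun y => 0 ≤ E.rcoroot i y) (fun x hx => ?_) (by simp)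
    (fun x y hx hy => ?_) (fun r x hr hx => ?_) hy
  · rw [rcoroot_toReal]; exact_mod_cast hx i hi
  · rw [map_add]; exact add_nonneg hx hy
  · rw [map_smul]; exact mul_nonneg hr hx

/-- The real Hasse cone is the image under `1 - qA` of the real dominant cone. -/
lemma mem_realCone_hasse {y : ℝ ⊗[ℤ] X} :
    y ∈ realCone E.hasse ↔ ∃ z, (∀ i ∈ E.Δ, 0 ≤ E.rcoroot i z) ∧ E.rh z = y := by
  constructor
  · intro hy
    refine realCone_induction
      (p := fun y => ∃ z, (∀ i ∈ E.Δ, 0 ≤ E.rcoroot i z) ∧ E.rh z = y) ?_ ?_ ?_ ?_ hy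
    · rintro _ ⟨x, hx, rfl⟩
      refine ⟨toReal x, fun i hi => ?_, E.rh_toReal x⟩
      rw [rcoroot_toReal]; exact_mod_cast hx i hi
    · exact ⟨0, by simp, map_zero _⟩
    · rintro _ _ ⟨z, hz, rfl⟩ ⟨z', hz', rfl⟩
      refine ⟨z + z', fun i hi => ?_, map_add _ _ _⟩
      rw [map_add]; exact add_nonneg (hz i hi) (hz' i hi)
    · rintro r _ hr ⟨z, hz, rfl⟩
      refine ⟨r • z, fun i hi => ?_, map_smul _ _ _⟩
      rw [map_smul]; exact mul_nonneg hr (hz i hi)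
  · rintro ⟨z, hz, rfl⟩
    have hz' := E.mem_realCone_dom (K := E.Δ) subset_rfl (by simpa using hz)
    refine realCone_induction (p := fun z => E.rh z ∈ realCone E.hasse) ?_ ?_ ?_ ?_ hz'
    · intro x hx
      rw [rh_toReal]
      exact toReal_mem_realCone ⟨x, hx, rfl⟩
    · simpa using zero_mem_realCone
    · intro x y hx hy
      rw [map_add]; exact add_mem_realCone hx hy
    · intro r x hr hx
      rw [map_smul]; exact smul_mem_realCone hr hx

lemma hasse_subset_dom : E.hasse ⊆ E.dom E.I := by
  rintro _ ⟨x, hx, rfl⟩ i hi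
  rw [h_apply, map_sub, map_nsmul, E.coroot_A i hi, smul_neg, sub_neg_eq_add]
  exact add_nonneg (hx i (E.I_subset hi)) (nsmul_nonneg (hx _ (E.τ_mem i hi)) _)

/-- If `τ` is the identity and `(1 - qA)z` satisfies the Griffiths–Schmid inequalities, then `z` is
dominant. On `I` the values are multiplied by `1 + q`. On `S`, the smallest value `f(s)` of `z`
satisfies `f(s) ≤ f(s') ≤ q f(s)`, where `s'` is the index whose coroot pulls back to that of `s`
under `A`; hence it is nonnegative. -/
lemma rcoroot_nonneg_of_rh [Finite ι] (hτ : ∀ i ∈ E.I, E.τ i = i) {z : ℝ ⊗[ℤ] X}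
    (hI : ∀ i ∈ E.I, 0 ≤ E.rcoroot i (E.rh z)) (hS : ∀ s ∈ E.S, E.rcoroot s (E.rh z) ≤ 0) :
    ∀ i ∈ E.Δ, 0 ≤ E.rcoroot i z := by
  have hq : (2 : ℝ) ≤ E.q := by exact_mod_cast E.two_le_q
  intro i hi
  by_cases hiI : i ∈ E.I
  · have := hI i hiI
    rw [E.rcoroot_rh_of_mem_I hiI, hτ i hiI] at this
    nlinarith
  · have hiS := E.mem_S i hi hiI
    obtain ⟨s, hs, hmin⟩ := (Set.toFinite E.S).exists_minimalFor (fun s => E.rcoroot s z) E.S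
      ⟨i, hiS⟩
    have hmin' : ∀ t ∈ E.S, E.rcoroot s z ≤ E.rcoroot t z := fun t ht => by
      by_contra! hlt
      exact absurd (hmin ht hlt.le) (not_le.mpr hlt)
    obtain ⟨s', hs', hA⟩ := E.exists_coroot_A hτ s hs
    have h1 := E.rcoroot_rh_eq (i := s') (j := s) (a := 1) (b := -E.q) (fun x => by
      rw [h_apply, map_sub, map_nsmul, hA, nsmul_eq_mul]; ring) z
    have h2 := hS s' hs'
    have h3 := hmin' s' hs'
    have h4 := hmin' i hiS
    push_cast at h1
    nlinarith

/-- The consequence that the neighborhood property and the inclusion of the Griffiths–Schmid cone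
have in common: translating an `I`-dominant weight far enough in a direction of `reg` leads into
the Hasse cone. -/
def AbsorbsDominant : Prop :=
  ∀ v ∈ E.dom E.I, ∀ x ∈ E.reg, ∃ m : ℕ, 1 ≤ m ∧ toReal (v + m • x) ∈ realCone E.hasse

lemma absorbsDominant_of_isNeighborhoodIn
    (H : IsNeighborhoodIn (realCone (E.dom E.I)) (realCone E.hasse) (toReal '' E.reg)) :
    E.AbsorbsDominant := by
  intro v hv x hx
  let t : TopologicalSpace (ℝ ⊗[ℤ] X) := moduleTopology ℝ (ℝ ⊗[ℤ] X)
  have : IsModuleTopology ℝ (ℝ ⊗[ℤ] X) := ⟨rfl⟩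
  have : ContinuousAdd (ℝ ⊗[ℤ] X) := IsModuleTopology.toContinuousAdd ℝ _
  have : ContinuousSMul ℝ (ℝ ⊗[ℤ] X) := IsModuleTopology.toContinuousSMul ℝ _
  have h1 := H.2.2 _ ⟨x, hx, rfl⟩
  have hlim : Filter.Tendsto (fun m : ℕ => toReal x + (1 / ((m : ℝ) + 1)) • toReal v) Filter.atTop
      (𝓝 (toReal x)) := by
    have := (tendsto_one_div_add_atTop_nhds_zero_nat (𝕜 := ℝ)).smul_const (toReal v)
    simpa using this.const_add (toReal x)
  have hxd : x ∈ E.dom E.I := fun i hi => (hx.1 i hi).ge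
  have hlim' := tendsto_nhdsWithin_of_tendsto_nhds_of_eventually_within _ hlim
    (s := realCone (E.dom E.I)) (Filter.Eventually.of_forall fun m =>
      add_mem_realCone (toReal_mem_realCone hxd)
        (smul_mem_realCone (by positivity) (toReal_mem_realCone hv)))
  obtain ⟨m, hm⟩ := (hlim'.eventually h1).exists
  refine ⟨m + 1, by omega, ?_⟩
  have hm' : ((m : ℝ) + 1) ≠ 0 := by positivity
  have := smul_mem_realCone (r := (m : ℝ) + 1) (by positivity) hm
  rw [smul_add, smul_smul, mul_one_div_cancel hm', one_smul] at this
  rw [toReal_add, toReal_nsmul, add_comm]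
  push_cast
  exact this

lemma absorbsDominant_of_gs_subset [Finite ι] (H : E.gs ⊆ saturation E.hasse) :
    E.AbsorbsDominant := by
  intro v hv x hx
  obtain ⟨m, hm⟩ := (Set.toFinite ((fun s => (E.coroot s v).natAbs) '' E.S)).bddAbove
  refine ⟨m + 1, by omega, toReal_mem_realCone_of_mem_saturation (H ⟨fun i hi => ?_,
    fun s hs => ?_⟩)⟩
  · rw [map_add, map_nsmul, hx.1 i hi, smul_zero, add_zero]
    exact hv i hi
  · have h1 : (E.coroot s v).natAbs ≤ m := hm ⟨s, hs, rfl⟩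
    have h2 := E.coroot_neg_of_regular x hx.1 hx.2 s hs
    rw [map_add, map_nsmul, nsmul_eq_mul]
    push_cast
    have h3 : E.coroot s v ≤ m := by omega
    nlinarith

/-- For instance, `reg` contains the negative of the sum of the fundamental weights outside `I`. -/
lemma exists_mem_reg : ∃ x, x ∈ E.reg := by
  classical
  refine ⟨-∑ j ∈ E.Δ with j ∉ E.I, E.weight j, fun i hi => ?_, fun i hi hiI => ?_⟩
  · rw [map_neg, map_sum, Finset.sum_eq_zero, neg_zero]
    intro j hj
    rw [Finset.mem_filter] at hj
    exact E.coroot_weight_of_ne i (E.I_subset hi) j hj.1 (fun h => hj.2 (h ▸ hi))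
  · rw [map_neg, map_sum, Finset.sum_eq_single i, E.coroot_weight_self i hi]
    · simpa using E.N_pos
    · intro j hj hji
      exact E.coroot_weight_of_ne i hi j (Finset.mem_filter.mp hj).1 hji.symm
    · exact fun h => absurd (Finset.mem_filter.mpr ⟨hi, hiI⟩) h

/-- The real weights that vanish on the coroots in `K`. -/
noncomputable def perp (K : Set ι) : Submodule ℝ (ℝ ⊗[ℤ] X) := ⨅ i ∈ K, LinearMap.ker (E.rcoroot i)

lemma mem_perp {K : Set ι} {y : ℝ ⊗[ℤ] X} : y ∈ E.perp K ↔ ∀ i ∈ K, E.rcoroot i y = 0 := by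
  simp [perp]

/-- If an `I`-orthogonal weight is of the form `(1 - qA)z` with `z` dominant, then the two
nonnegative summands of its values on `I` vanish. -/
lemma exists_mem_perp_union (H : E.AbsorbsDominant) {v : X} (hv : ∀ i ∈ E.I, E.coroot i v = 0) :
    toReal v ∈ (E.perp (E.I ∪ E.τ '' E.I)).map E.rh := by
  have key : ∀ v : X, (∀ i ∈ E.I, E.coroot i v = 0) → toReal v ∈ realCone E.hasse →
      toReal v ∈ (E.perp (E.I ∪ E.τ '' E.I)).map E.rh := by
    intro v hv h
    obtain ⟨z, hz, hzv⟩ := E.mem_realCone_hasse.mp h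
    have h0 : ∀ i ∈ E.I, E.rcoroot i z = 0 ∧ E.rcoroot (E.τ i) z = 0 := by
      intro i hi
      have h1 := E.rcoroot_rh_of_mem_I hi z
      rw [hzv, rcoroot_toReal, hv i hi, Int.cast_zero] at h1
      have h2 := hz i (E.I_subset hi)
      have h3 := hz _ (E.τ_mem i hi)
      have hq : (2 : ℝ) ≤ E.q := by exact_mod_cast E.two_le_q
      constructor <;> nlinarith
    refine ⟨z, E.mem_perp.mpr ?_, hzv⟩
    rintro _ (hi | ⟨i, hi, rfl⟩)
    · exact (h0 _ hi).1
    · exact (h0 i hi).2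
  obtain ⟨x, hx⟩ := E.exists_mem_reg
  obtain ⟨m, -, h1⟩ := H v (fun i hi => (hv i hi).ge) x hx
  obtain ⟨m', hm', h2⟩ := H 0 (fun i _ => by simp) x hx
  rw [zero_add] at h2
  have h3 := key _ (fun i hi => by rw [map_add, map_nsmul, hv i hi, hx.1 i hi]; simp) h1
  have h4 := key _ (fun i hi => by rw [map_nsmul, hx.1 i hi]; simp) h2
  rw [toReal_nsmul] at h4
  have hm0 : (m' : ℝ) ≠ 0 := by positivity
  have h5 := Submodule.smul_mem _ ((m : ℝ) * (m' : ℝ)⁻¹) h4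
  rw [smul_smul, inv_mul_cancel_right₀ hm0] at h5
  have := Submodule.sub_mem _ h3 h5
  rwa [toReal_add, toReal_nsmul, add_sub_cancel_right] at this

lemma perp_le_span :
    E.perp E.I ≤ Submodule.span ℝ (toReal '' {v | ∀ i ∈ E.I, E.coroot i v = 0}) := by
  intro y hy
  rw [mem_perp] at hy
  obtain ⟨z, hz, h⟩ := E.exists_smul_eq_add_sum_weight y
  have hN : (E.N : ℝ) ≠ 0 := by exact_mod_cast E.N_pos.ne'
  rw [← inv_smul_smul₀ hN y, h]
  refine Submodule.smul_mem _ _ (Submodule.add_mem _ (Submodule.span_mono ?_ hz)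
    (Submodule.sum_mem _ fun i hi => ?_))
  · exact Set.image_mono fun v hv i hi => hv i (E.I_subset hi)
  · by_cases hiI : i ∈ E.I
    · rw [hy i hiI, zero_smul]
      exact Submodule.zero_mem _
    · exact Submodule.smul_mem _ _ (Submodule.subset_span ⟨_, fun j hj =>
        E.coroot_weight_of_ne j (E.I_subset hj) i hi (fun h => hiI (h ▸ hj)), rfl⟩)

/-- `1 - qA` maps the orthogonal complement of `I ∪ τI` onto that of `I`, so the two complements
have the same dimension and `τI ⊆ I`. -/
lemma τ_mem_I [Module.Finite ℤ X] (H : E.AbsorbsDominant) {i : ι} (hi : i ∈ E.I) :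
    E.τ i ∈ E.I := by
  have h1 : E.perp E.I ≤ (E.perp (E.I ∪ E.τ '' E.I)).map E.rh := by
    refine E.perp_le_span.trans (Submodule.span_le.mpr ?_)
    rintro _ ⟨v, hv, rfl⟩
    exact E.exists_mem_perp_union H hv
  have h2 : E.perp (E.I ∪ E.τ '' E.I) ≤ E.perp E.I := fun y hy =>
    E.mem_perp.mpr fun i hi => E.mem_perp.mp hy i (Or.inl hi)
  have h3 : E.perp (E.I ∪ E.τ '' E.I) = E.perp E.I :=
    Submodule.eq_of_le_of_finrank_le h2
      ((Submodule.finrank_mono h1).trans (Submodule.finrank_map_le _ _))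
  by_contra hτ
  have h4 : toReal (E.weight (E.τ i)) ∈ E.perp E.I := E.mem_perp.mpr fun j hj => by
    rw [rcoroot_toReal, E.coroot_weight_of_ne j (E.I_subset hj) _ (E.τ_mem i hi)
      (fun h => hτ (h ▸ hj)), Int.cast_zero]
  rw [← h3] at h4
  have h5 := E.mem_perp.mp h4 (E.τ i) (Or.inr ⟨i, hi, rfl⟩)
  rw [rcoroot_toReal, E.coroot_weight_self _ (E.τ_mem i hi)] at h5
  exact E.N_pos.ne' (by exact_mod_cast h5)

/-- If `τ` permutes `I` without fixing `i`, then the weight `ϖ_i`, translated into the Hasse cone,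
is `(1 - qA)z` with `z` dominant, and the values of `z` on `i` and `τ i` are forced to vanish by
the vanishing of `ϖ_i` on `τ⁻¹ i` and `τ i`. -/
lemma τ_eq_self [Module.Finite ℤ X] [Finite ι] (H : E.AbsorbsDominant) {i : ι}
    (hi : i ∈ E.I) : E.τ i = i := by
  have hmaps : Set.MapsTo E.τ E.I E.I := fun i hi => E.τ_mem_I H hi
  have hsurj : Set.SurjOn E.τ E.I E.I :=
    (((Set.toFinite E.I).injOn_iff_bijOn_of_mapsTo hmaps).mp E.τ_injOn).surjOn
  by_contra hne
  obtain ⟨x, hx⟩ := E.exists_mem_reg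
  have hw : ∀ j ∈ E.I, j ≠ i → E.coroot j (E.weight i) = 0 := fun j hj hji =>
    E.coroot_weight_of_ne j (E.I_subset hj) i (E.I_subset hi) hji
  have hN : (0 : ℝ) < E.N := by exact_mod_cast E.N_pos
  obtain ⟨m, -, hm⟩ := H (E.weight i) (fun j hj => by
    by_cases hji : j = i
    · rw [hji, E.coroot_weight_self i (E.I_subset hi)]; positivity
    · rw [hw j hj hji]) x hx
  obtain ⟨z, hz, hzv⟩ := E.mem_realCone_hasse.mp hm
  have hq : (2 : ℝ) ≤ E.q := by exact_mod_cast E.two_le_q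
  have h0 : ∀ j ∈ E.I, j ≠ i → E.rcoroot j z = 0 ∧ E.rcoroot (E.τ j) z = 0 := by
    intro j hj hji
    have h1 := E.rcoroot_rh_of_mem_I hj z
    rw [hzv, rcoroot_toReal, map_add, map_nsmul, hw j hj hji, hx.1 j hj] at h1
    simp only [smul_zero, add_zero, Int.cast_zero] at h1
    have h2 := hz j (E.I_subset hj)
    have h3 := hz _ (E.τ_mem j hj)
    constructor <;> nlinarith
  have h1 := E.rcoroot_rh_of_mem_I hi z
  rw [hzv, rcoroot_toReal, map_add, map_nsmul, E.coroot_weight_self i (E.I_subset hi),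
    hx.1 i hi, (h0 _ (hmaps hi) hne).1] at h1
  obtain ⟨j, hj, hji⟩ := hsurj hi
  have h2 := (h0 j hj (fun h => hne (h ▸ hji))).2
  rw [hji] at h2
  rw [h2] at h1
  simp only [smul_zero, add_zero, mul_zero] at h1
  exact E.N_pos.ne' (by exact_mod_cast h1)

/-- The Hasse cone is a neighborhood of `reg` in the `I`-dominant cone, if and only if its
saturation contains the Griffiths–Schmid cone, if and only if `τ` is the identity of `I`. -/
theorem tfae [Module.Finite ℤ X] [Module.Free ℤ X] [Finite ι] : List.TFAE [
    IsNeighborhoodIn (realCone (E.dom E.I)) (realCone E.hasse) (toReal '' E.reg),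
    E.gs ⊆ saturation E.hasse,
    ∀ i ∈ E.I, E.τ i = i] := by
  tfae_have 1 → 3 := fun H i hi => E.τ_eq_self (E.absorbsDominant_of_isNeighborhoodIn H) hi
  tfae_have 2 → 3 := fun H i hi => E.τ_eq_self (E.absorbsDominant_of_gs_subset H) hi
  tfae_have 3 → 2 := by
    intro hτ x hx
    obtain ⟨m, hm, hy⟩ := E.exists_h_eq_nsmul
    obtain ⟨y, hy⟩ := hy x
    refine ⟨m, hm, y, fun i hi => ?_, hy⟩
    have := E.rcoroot_nonneg_of_rh hτ (z := toReal y) (fun i hi => ?_) (fun s hs => ?_) i hi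
    · rw [rcoroot_toReal] at this
      exact_mod_cast this
    · rw [rh_toReal, hy, rcoroot_toReal, map_nsmul]
      exact_mod_cast nsmul_nonneg (hx.1 i hi) m
    · rw [rh_toReal, hy, rcoroot_toReal, map_nsmul]
      exact_mod_cast nsmul_nonpos (hx.2 s hs) m
  tfae_have 3 → 1 := by
    intro hτ
    refine ⟨realCone_mono fun x hx => toReal_mem_realCone (E.hasse_subset_dom hx), ?_, ?_⟩
    · rintro _ ⟨x, hx, rfl⟩
      exact toReal_mem_realCone fun i hi => (hx.1 i hi).ge
    · rintro _ ⟨x, hx, rfl⟩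
      let t : TopologicalSpace (ℝ ⊗[ℤ] X) := moduleTopology ℝ (ℝ ⊗[ℤ] X)
      have : IsModuleTopology ℝ (ℝ ⊗[ℤ] X) := ⟨rfl⟩
      -- the open set of weights that are negative on all of `S`
      have hU : {y | ∀ s ∈ E.S, E.rcoroot s y < 0} ∈ 𝓝 (toReal x) := by
        refine (Filter.eventually_all_finite (Set.toFinite E.S)).mpr fun s hs => ?_
        refine (isOpen_lt (IsModuleTopology.continuous_of_linearMap (E.rcoroot s))
          continuous_const).mem_nhds ?_
        change E.rcoroot s (toReal x) < 0
        rw [rcoroot_toReal]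
        exact_mod_cast E.coroot_neg_of_regular x hx.1 hx.2 s hs
      refine Filter.mem_of_superset (inter_mem_nhdsWithin _ hU) ?_
      rintro y ⟨hyI, hyS⟩
      obtain ⟨z, rfl⟩ := E.rh_surjective y
      exact E.mem_realCone_hasse.mpr ⟨z, E.rcoroot_nonneg_of_rh hτ
        (E.rcoroot_nonneg_of_mem_realCone_dom hyI) (fun s hs => (hyS s hs).le), rfl⟩
  tfae_finish

end TwistedSystem

/-! ### Bases of root data -/

section RootDatum

variable {ι X Y : Type*} [AddCommGroup X] [AddCommGroup Y]

lemma isAddTorsionFree (R : RootDatum ι X Y) : IsAddTorsionFree X where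
  nsmul_right_injective n hn x y hxy := by
    refine R.toPerfPair.injective (LinearMap.ext fun c => ?_)
    have h := congrArg (fun z => R.toLinearMap z c) hxy
    simp only [map_nsmul, LinearMap.smul_apply] at h
    exact nsmul_right_injective hn h

/-- Fundamental weights exist up to a common positive factor, since the Cartan matrix is
invertible over `ℚ`. -/
lemma exists_fundamentalWeights [Finite ι] (R : RootDatum ι X Y) (b : R.Base) :
    ∃ (N : ℕ) (ϖ : ι → X), 0 < N ∧ (∀ i ∈ b.support, R.toLinearMap (ϖ i) (R.coroot i) = N) ∧
      ∀ i ∈ b.support, ∀ j ∈ b.support, i ≠ j → R.toLinearMap (ϖ j) (R.coroot i) = 0 := by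
  classical
  have : Fintype ι := Fintype.ofFinite ι
  let C : Matrix b.support b.support ℤ := .of fun i j => R.pairing i j
  have hC : C.det ≠ 0 := by
    intro h
    obtain ⟨v, hv, hv'⟩ := Matrix.exists_vecMul_eq_zero_iff.mpr h
    set x : X := ∑ i, v i • R.root (i : ι) with hx
    have h1 : ∀ j ∈ b.support, R.toLinearMap x (R.coroot j) = 0 := fun j hj => by
      simpa [hx, Matrix.vecMul, dotProduct, C] using congrFun hv' ⟨j, hj⟩
    have h2 : ∀ j, R.toLinearMap x (R.coroot j) = 0 := fun j => by
      have hle : Submodule.span ℤ (R.coroot '' b.support) ≤ LinearMap.ker (R.toLinearMap x) :=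
        Submodule.span_le.mpr (by rintro _ ⟨j, hj, rfl⟩; exact h1 j hj)
      exact hle (b.coroot_mem_span_int j)
    have h3 : x = 0 := by
      refine R.eq_zero_of_mem_rootSpan_of_rootForm_self_eq_zero ?_ ?_
      · exact Submodule.sum_mem _ fun i _ => Submodule.smul_mem _ _
          (Submodule.subset_span ⟨i, rfl⟩)
      · rw [R.rootForm_apply_apply]
        refine Finset.sum_eq_zero fun j _ => ?_
        change R.toLinearMap x (R.coroot j) * R.toLinearMap x (R.coroot j) = 0
        rw [h2, mul_zero]
    exact hv (funext fun i => Fintype.linearIndependent_iff.mp b.linearIndepOn_root v h3 i)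
  -- the rows of `adj(C)` give the weights up to `det C`; one more factor `det C` fixes the sign
  let ϖ : ι → X := fun j => if hj : j ∈ b.support then
    C.det • ∑ i, C.adjugate ⟨j, hj⟩ i • R.root (i : ι) else 0
  have key : ∀ (i j : b.support), R.toLinearMap (ϖ j) (R.coroot i) =
      C.det * (C.det * if j = i then 1 else 0) := by
    intro i j
    have h := congrFun (congrFun C.adjugate_mul j) i
    rw [Matrix.smul_apply, Matrix.one_apply, smul_eq_mul, Matrix.mul_apply] at h
    simp [ϖ, ← h, C]
  refine ⟨(C.det ^ 2).natAbs, ϖ, by positivity, fun i hi => ?_, fun i hi j hj hij => ?_⟩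
  · rw [key ⟨i, hi⟩ ⟨i, hi⟩, if_pos rfl, Int.natAbs_pow, Nat.cast_pow, Int.natCast_natAbs, sq_abs]
    ring
  · rw [key ⟨i, hi⟩ ⟨j, hj⟩, if_neg (by simpa using hij.symm), mul_zero, mul_zero]

/-- A functional taking the same positive value on all simple roots. -/
lemma exists_heightFunctional [Finite ι] (R : RootDatum ι X Y) (b : R.Base) :
    ∃ (N : ℤ) (ht : X →ₗ[ℤ] ℤ), 0 < N ∧ ∀ i ∈ b.support, ht (R.root i) = N := by
  obtain ⟨N, ϖ, hN, h1, h2⟩ := exists_fundamentalWeights R.flip b.flip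
  refine ⟨N, R.toLinearMap.flip (∑ j ∈ b.support, ϖ j), by exact_mod_cast hN, fun i hi => ?_⟩
  rw [map_sum, LinearMap.sum_apply, Finset.sum_eq_single i]
  · exact h1 i hi
  · exact fun j hj hji => h2 i hi j hj hji.symm
  · exact fun h => absurd hi h

variable {R : RootDatum ι X Y} {b : R.Base}

/-- The index of the negative of a root. -/
def negIndex (R : RootDatum ι X Y) (i : ι) : ι := R.reflectionPerm i i

lemma root_negIndex (i : ι) : R.root (negIndex R i) = -R.root i := by
  simp [negIndex, R.root_reflectionPerm]

lemma coroot_negIndex (i : ι) : R.coroot (negIndex R i) = -R.coroot i := by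
  simp [negIndex, R.coroot_reflectionPerm]

lemma isPos_negIndex (i : ι) : b.IsPos (negIndex R i) ↔ ¬ b.IsPos i :=
  RootPairing.Base.IsPos.neg_iff_not b i

lemma exists_root_eq_sum_of_isPos {i : ι} (hi : b.IsPos i) :
    ∃ f : ι → ℕ, R.root i = ∑ j ∈ b.support, f j • R.root j := by
  obtain ⟨f, -, hf | hf⟩ := b.exists_root_eq_sum_nat_or_neg i
  · exact ⟨f, hf⟩
  · have h := RootPairing.Base.height_eq_sum (b := b) (i := i) (f := fun j => -(f j : ℤ))
      (by rw [hf]; simp)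
    rw [b.isPos_iff, h, Finset.sum_neg_distrib] at hi
    have : (0 : ℤ) ≤ ∑ j ∈ b.support, (f j : ℤ) := Finset.sum_nonneg fun j _ => by positivity
    omega

/-- A simple reflection permutes the positive roots other than its own simple root. -/
lemma isPos_reflectionPerm [Finite ι] {i j : ι}
    (hi : b.IsPos i) (hj : j ∈ b.support) (hij : i ≠ j) : b.IsPos (R.reflectionPerm j i) := by
  classical
  have := isAddTorsionFree R
  have := isAddTorsionFree R.flip
  obtain ⟨f, hf⟩ := exists_root_eq_sum_of_isPos hi
  by_contra hneg
  rw [← isPos_negIndex] at hneg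
  obtain ⟨g, hg⟩ := exists_root_eq_sum_of_isPos hneg
  rw [root_negIndex, R.root_reflectionPerm, R.reflection_apply_root] at hg
  set p := R.pairing i j
  -- the coefficients of `f` and `-g` agree away from `j`, so `f` is supported at `j`
  have h0 : ∑ m ∈ b.support, ((f m : ℤ) + g m - if m = j then p else 0) • R.root m = 0 := by
    have h1 : ∑ m ∈ b.support, (if m = j then p else 0) • R.root m = p • R.root j := by
      rw [Finset.sum_eq_single j] <;> simp +contextual [hj]
    simp only [sub_smul, add_smul, Finset.sum_sub_distrib, Finset.sum_add_distrib, h1,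
      natCast_zsmul, ← hf, ← hg]
    abel
  have h2 := linearIndepOn_iff'.mp b.linearIndepOn_root b.support _ subset_rfl h0
  have h3 : ∀ m ∈ b.support, m ≠ j → f m = 0 := fun m hm hmj => by
    have := h2 m hm
    rw [if_neg hmj] at this
    omega
  have h4 : R.root i = (f j : ℤ) • R.root j := by
    rw [hf, Finset.sum_eq_single j (fun m hm hmj => by rw [h3 m hm hmj, zero_smul])
      (fun h => absurd hj h), natCast_zsmul]
  rcases b.eq_one_or_neg_one_of_mem_support_of_smul_mem j hj (f j : ℤ) ⟨i, h4⟩ with h | h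
  · rw [h, one_smul] at h4
    exact hij (R.root.injective h4)
  · omega

/-! ### Automorphisms of root data -/

/-- The automorphism `g` of the character lattice permutes the roots by `π`, and its contragredient
permutes the coroots in the same way. -/
structure IsRootAut (R : RootDatum ι X Y) (g : X ≃ₗ[ℤ] X) (π : Equiv.Perm ι) : Prop where
  map_root : ∀ i, g (R.root i) = R.root (π i)
  pairing_map : ∀ x i, R.toLinearMap (g x) (R.coroot (π i)) = R.toLinearMap x (R.coroot i)

namespace IsRootAut

lemma one : IsRootAut R 1 1 := ⟨fun _ => rfl, fun _ _ => rfl⟩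

lemma mul {g g' : X ≃ₗ[ℤ] X} {π π' : Equiv.Perm ι} (h : IsRootAut R g π) (h' : IsRootAut R g' π') :
    IsRootAut R (g * g') (π * π') where
  map_root i := by
    rw [LinearEquiv.mul_apply, h'.map_root, h.map_root, Equiv.Perm.mul_apply]
  pairing_map x i := by
    rw [LinearEquiv.mul_apply, Equiv.Perm.mul_apply, h.pairing_map, h'.pairing_map]

lemma inv {g : X ≃ₗ[ℤ] X} {π : Equiv.Perm ι} (h : IsRootAut R g π) : IsRootAut R g⁻¹ π⁻¹ where
  map_root i := by
    apply g.injective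
    rw [h.map_root, show π (π⁻¹ i) = i from π.apply_symm_apply i]
    exact g.apply_symm_apply _
  pairing_map x i := by
    rw [← h.pairing_map, show π (π⁻¹ i) = i from π.apply_symm_apply i,
      show g (g⁻¹ x) = x from g.apply_symm_apply x]

lemma reflection (i : ι) : IsRootAut R (R.reflection i) (R.reflectionPerm i) where
  map_root j := (R.root_reflectionPerm i j).symm
  pairing_map x j := by
    have h := R.coroot'_reflection (i := i) (j := R.reflectionPerm i j) x
    rwa [R.reflectionPerm_self] at h

lemma mul_reflection {g : X ≃ₗ[ℤ] X} {π : Equiv.Perm ι} (h : IsRootAut R g π) (i : ι) :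
    g * R.reflection i = R.reflection (π i) * g := by
  ext x
  rw [LinearEquiv.mul_apply, LinearEquiv.mul_apply, R.reflection_apply, R.reflection_apply, map_sub,
    map_smul, h.map_root]
  congr 2
  exact (h.pairing_map x i).symm

lemma list_prod (l : List ι) :
    IsRootAut R (l.map R.reflection).prod (l.map R.reflectionPerm).prod := by
  induction l with
  | nil => exact one
  | cons i l ih => simpa using (reflection i).mul ih

end IsRootAut

/-! ### The longest element of a parabolic subgroup of the Weyl group -/

/-- The exchange condition: if a product of simple reflections makes a simple root negative, then
multiplying by the corresponding reflection amounts to deleting a factor. -/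
lemma exists_list_prod_mul_reflection [Finite ι]
    {i : ι} (hi : i ∈ b.support) (l : List ι) (hl : ∀ j ∈ l, j ∈ b.support)
    (hneg : ¬ b.IsPos ((l.map R.reflectionPerm).prod i)) :
    ∃ l' : List ι, (∀ j ∈ l', j ∈ b.support) ∧ l'.length + 1 = l.length ∧
      (l'.map R.reflection).prod = (l.map R.reflection).prod * R.reflection i := by
  induction l with
  | nil => exact absurd (b.isPos_of_mem_support hi) hneg
  | cons j l ih =>
    have hj := hl j List.mem_cons_self
    have hl' : ∀ m ∈ l, m ∈ b.support := fun m hm => hl m (List.mem_cons_of_mem j hm)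
    by_cases hpos : b.IsPos ((l.map R.reflectionPerm).prod i)
    · -- the root `α_j` is the only positive root made negative by the `j`-th reflection
      have hij : (l.map R.reflectionPerm).prod i = j := by
        by_contra hne
        exact hneg (by simpa using isPos_reflectionPerm hpos hj hne)
      refine ⟨l, hl', rfl, ?_⟩
      rw [List.map_cons, List.prod_cons, mul_assoc, (IsRootAut.list_prod l).mul_reflection i, hij,
        ← mul_assoc, ← sq, R.reflection_sq, one_mul]
    · obtain ⟨l', h1, h2, h3⟩ := ih hl' hpos
      refine ⟨j :: l', ?_, by simpa using h2, ?_⟩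
      · intro m hm
        rcases List.mem_cons.mp hm with rfl | hm
        · exact hj
        · exact h1 m hm
      · rw [List.map_cons, List.prod_cons, h3, List.map_cons, List.prod_cons, mul_assoc]

lemma exists_list_of_mem_reflectionSubgroup {K : Set ι} {w : X ≃ₗ[ℤ] X}
    (hw : w ∈ reflectionSubgroup R K) :
    ∃ l : List ι, (∀ j ∈ l, j ∈ K) ∧ (l.map R.reflection).prod = w := by
  induction hw using Subgroup.closure_induction with
  | mem x hx =>
    obtain ⟨i, hi, rfl⟩ := hx
    exact ⟨[i], by simpa using hi, by simp⟩
  | one => exact ⟨[], by simp, rfl⟩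
  | mul x y _ _ hx hy =>
    obtain ⟨l, hl, rfl⟩ := hx
    obtain ⟨l', hl', rfl⟩ := hy
    refine ⟨l ++ l', fun j hj => ?_, by simp⟩
    rcases List.mem_append.mp hj with h | h
    · exact hl j h
    · exact hl' j h
  | inv x _ hx =>
    obtain ⟨l, hl, rfl⟩ := hx
    refine ⟨l.reverse, fun j hj => hl j (List.mem_reverse.mp hj), ?_⟩
    rw [List.prod_inv_reverse, List.map_reverse, List.map_map]
    congr 2

/-- The longest element of `W_I` makes all simple roots in `I` negative. -/
lemma IsLongestElement.not_isPos [Finite ι]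
    {I : Set ι} (hI : I ⊆ b.support) {w : X ≃ₗ[ℤ] X} (hw : IsLongestElement R b I w)
    {π : Equiv.Perm ι} (hπ : IsRootAut R w π) {i : ι} (hi : i ∈ I) : ¬ b.IsPos (π i) := by
  intro hpos
  have hv : w * R.reflection i ∈ reflectionSubgroup R I :=
    mul_mem hw.1 (Subgroup.subset_closure ⟨i, hi, rfl⟩)
  obtain ⟨l₀, hl₀, hl₀'⟩ := exists_list_of_mem_reflectionSubgroup hv
  -- a reduced word for `w s_i`
  obtain ⟨l, hl, hprod, hlen⟩ : weylLength R b (w * R.reflection i) ∈ {m | ∃ l : List ι,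
      (∀ i ∈ l, i ∈ b.support) ∧ (l.map R.reflection).prod = w * R.reflection i ∧ l.length = m} :=
    Nat.sInf_mem ⟨_, l₀, fun j hj => hI (hl₀ j hj), hl₀', rfl⟩
  have hroot : (l.map R.reflectionPerm).prod i = negIndex R (π i) := by
    apply R.root.injective
    rw [← (IsRootAut.list_prod l).map_root, hprod, LinearEquiv.mul_apply, R.reflection_apply_self,
      map_neg, hπ.map_root, root_negIndex]
  obtain ⟨l', h1, h2, h3⟩ := exists_list_prod_mul_reflection (hI hi) l hl
    (by rw [hroot, isPos_negIndex]; exact not_not.mpr hpos)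
  rw [hprod, mul_assoc, ← sq, R.reflection_sq, mul_one] at h3
  have h4 : weylLength R b w ≤ l'.length := Nat.sInf_le ⟨l', h1, h3, rfl⟩
  have h5 := hw.2 _ hv
  omega

/-! ### Automorphisms permuting simple roots -/

/-- An automorphism permutes the simple roots in `J`, if it and its inverse map them to nonnegative
combinations of simple roots in `J`: compare heights. -/
lemma exists_map_root_eq [Finite ι] {J : Set ι} (hJ : J ⊆ b.support) (g : X ≃ₗ[ℤ] X)
    (hg : ∀ j ∈ J, g (R.root j) ∈ AddSubmonoid.closure (R.root '' J))
    (hg' : ∀ j ∈ J, g.symm (R.root j) ∈ AddSubmonoid.closure (R.root '' J)) {j : ι} (hj : j ∈ J) :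
    ∃ j' ∈ J, g (R.root j) = R.root j' := by
  obtain ⟨N, ht, hN, hht⟩ := exists_heightFunctional R b
  set M := AddSubmonoid.closure (R.root '' J)
  have h1 : ∀ x ∈ M, x = 0 ∨ N ≤ ht x := by
    intro x hx
    induction hx using AddSubmonoid.closure_induction with
    | mem x hx =>
      obtain ⟨i, hi, rfl⟩ := hx
      exact Or.inr (hht i (hJ hi)).ge
    | zero => exact Or.inl rfl
    | add x y _ _ hx hy =>
      rcases hx with rfl | hx
      · simpa using hy
      · rcases hy with rfl | hy
        · simpa using Or.inr hx
        · right
          rw [map_add]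
          omega
  have h2 : ∀ x ∈ M, x = 0 ∨ x ∈ R.root '' J ∨ ∃ y ∈ M, ∃ z ∈ M, y ≠ 0 ∧ z ≠ 0 ∧ x = y + z := by
    intro x hx
    induction hx using AddSubmonoid.closure_induction with
    | mem x hx => exact Or.inr (Or.inl hx)
    | zero => exact Or.inl rfl
    | add x y hxM hyM hx hy =>
      rcases eq_or_ne x 0 with rfl | hx0
      · simpa using hy
      · rcases eq_or_ne y 0 with rfl | hy0
        · simpa using hx
        · exact Or.inr (Or.inr ⟨x, hxM, y, hyM, hx0, hy0, rfl⟩)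
  have h3 : ∀ x ∈ M, g.symm x ∈ M := by
    intro x hx
    induction hx using AddSubmonoid.closure_induction with
    | mem x hx =>
      obtain ⟨i, hi, rfl⟩ := hx
      exact hg' i hi
    | zero => rw [map_zero]; exact zero_mem _
    | add x y _ _ hx hy => rw [map_add]; exact add_mem hx hy
  rcases h2 _ (hg j hj) with h | ⟨j', hj', h⟩ | ⟨y, hy, z, hz, hy0, hz0, h⟩
  · exact absurd ((map_eq_zero_iff g g.injective).mp h) (R.ne_zero j)
  · exact ⟨j', hj', h.symm⟩
  · have h4 : R.root j = g.symm y + g.symm z := by rw [← map_add, ← h, g.symm_apply_apply]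
    have h5 := (h1 _ (h3 y hy)).resolve_left (by simpa using hy0)
    have h6 := (h1 _ (h3 z hz)).resolve_left (by simpa using hz0)
    have h7 := hht j (hJ hj)
    rw [h4, map_add] at h7
    omega

/-! ### The Levi part of a base -/

/-- The simple roots orthogonal to a coweight `μ`. -/
def leviBase (R : RootDatum ι X Y) (b : R.Base) (μ : Y) : Set ι :=
  {i | i ∈ b.support ∧ R.toLinearMap (R.root i) μ = 0}

/-- A positive root orthogonal to a dominant coweight is a sum of simple roots orthogonal to it. -/
lemma root_mem_closure_leviBase {μ : Y} (hμ : ∀ i, b.IsPos i → 0 ≤ R.toLinearMap (R.root i) μ)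
    {i : ι} (hi : b.IsPos i) (h0 : R.toLinearMap (R.root i) μ = 0) :
    R.root i ∈ AddSubmonoid.closure (R.root '' leviBase R b μ) := by
  obtain ⟨f, hf⟩ := exists_root_eq_sum_of_isPos hi
  rw [hf, map_sum, LinearMap.sum_apply] at h0
  simp only [map_nsmul, LinearMap.smul_apply] at h0
  have h1 := (Finset.sum_eq_zero_iff_of_nonneg fun j hj =>
    nsmul_nonneg (hμ j (b.isPos_of_mem_support hj)) (f j)).mp h0
  rw [hf]
  refine sum_mem fun j hj => ?_
  rcases smul_eq_zero.mp (h1 j hj) with h | h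
  · rw [h, zero_smul]
    exact zero_mem _
  · have hjI : j ∈ leviBase R b μ := ⟨hj, h⟩
    exact nsmul_mem (AddSubmonoid.subset_closure (Set.mem_image_of_mem _ hjI)) _

lemma pairing_eq_zero_of_mem_closure_leviBase {μ : Y} {x : X}
    (hx : x ∈ AddSubmonoid.closure (R.root '' leviBase R b μ)) : R.toLinearMap x μ = 0 := by
  induction hx using AddSubmonoid.closure_induction with
  | mem x hx =>
    obtain ⟨i, hi, rfl⟩ := hx
    exact hi.2
  | zero => simp
  | add x y _ _ hx hy => rw [map_add, LinearMap.add_apply, hx, hy, add_zero]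

lemma isPos_of_pairing_pos {μ : Y} (hμ : ∀ i, b.IsPos i → 0 ≤ R.toLinearMap (R.root i) μ) {i : ι}
    (hi : 0 < R.toLinearMap (R.root i) μ) : b.IsPos i := by
  by_contra h
  rw [← isPos_negIndex] at h
  have := hμ _ h
  rw [root_negIndex, map_neg, LinearMap.neg_apply] at this
  omega

/-- A character which vanishes on the simple coroots of the Levi part and is negative on the
others, is negative on the coroots of all positive roots outside the Levi part. The canonical form
turns the expansion of a coroot in simple coroots into one of the root in simple roots. -/
lemma pairing_coroot_neg [Finite ι] {μ : Y}
    (hμ : ∀ i, b.IsPos i → 0 ≤ R.toLinearMap (R.root i) μ) {x : X}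
    (h0 : ∀ i ∈ leviBase R b μ, R.toLinearMap x (R.coroot i) = 0)
    (h1 : ∀ i ∈ b.support, i ∉ leviBase R b μ → R.toLinearMap x (R.coroot i) < 0) {s : ι}
    (hs : 0 < R.toLinearMap (R.root s) μ) : R.toLinearMap x (R.coroot s) < 0 := by
  have : Fintype ι := Fintype.ofFinite ι
  set c : ι → ℤ := fun i => R.CorootForm (R.coroot i) (R.coroot i)
  have hc : ∀ i, 0 < c i := fun i => by
    change 0 < R.CorootForm (R.coroot i) (R.coroot i)
    rw [R.corootForm_apply_apply]
    refine Finset.sum_pos' (fun j _ => mul_self_nonneg _) ⟨i, Finset.mem_univ i, ?_⟩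
    rw [R.root'_coroot_eq_pairing, R.pairing_same]
    norm_num
  have hcop : ∀ i, c i • R.root i = 2 • R.CoPolarization (R.coroot i) :=
    R.corootForm_self_smul_root
  -- the coroot form converts coefficients of a coroot into coefficients of the root
  have key : ∀ f : ι → ℤ, R.coroot s = ∑ j ∈ b.support, f j • R.coroot j →
      c s * R.toLinearMap (R.root s) μ =
        ∑ j ∈ b.support, f j * (c j * R.toLinearMap (R.root j) μ) := by
    intro f hf
    have h2 : c s • R.root s = ∑ j ∈ b.support, f j • c j • R.root j := by
      rw [hcop, hf, map_sum, Finset.smul_sum]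
      refine Finset.sum_congr rfl fun j _ => ?_
      rw [hcop, map_zsmul, smul_comm]
    have h3 := congrArg (fun z => R.toLinearMap z μ) h2
    simpa using h3
  have hterm : ∀ j ∈ b.support, 0 ≤ c j * R.toLinearMap (R.root j) μ := fun j hj =>
    mul_nonneg (hc j).le (hμ j (b.isPos_of_mem_support hj))
  have hpos : 0 < c s * R.toLinearMap (R.root s) μ := mul_pos (hc s) hs
  have hx : ∀ j ∈ b.support, R.toLinearMap x (R.coroot j) ≤ 0 := fun j hj => by
    by_cases hjI : j ∈ leviBase R b μ
    · exact (h0 j hjI).le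
    · exact (h1 j hj hjI).le
  obtain ⟨f, -, hf | hf⟩ := b.flip.exists_root_eq_sum_nat_or_neg s
  · change R.coroot s = ∑ j ∈ b.support, f j • R.coroot j at hf
    have h2 := key (fun j => f j) (by simpa using hf)
    obtain ⟨j, hj, hj'⟩ := Finset.exists_lt_of_sum_lt (s := b.support) (f := fun _ => (0 : ℤ))
      (g := fun j => (f j : ℤ) * (c j * R.toLinearMap (R.root j) μ))
      (by rw [Finset.sum_const_zero, ← h2]; exact hpos)
    have hfj : 0 < f j := Nat.pos_of_ne_zero fun h => by simp [h] at hj'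
    have hjI : j ∉ leviBase R b μ := fun h => by simp [h.2] at hj'
    rw [hf, map_sum]
    refine Finset.sum_neg' (fun m hm => ?_) ⟨j, hj, ?_⟩
    · rw [map_nsmul]
      exact nsmul_nonpos (hx m hm) _
    · rw [map_nsmul, nsmul_eq_mul]
      exact mul_neg_of_pos_of_neg (by exact_mod_cast hfj) (h1 j hj hjI)
  · change R.coroot s = -∑ j ∈ b.support, f j • R.coroot j at hf
    have h2 := key (fun j => -(f j : ℤ)) (by simpa using hf)
    have h3 : ∑ j ∈ b.support, -(f j : ℤ) * (c j * R.toLinearMap (R.root j) μ) ≤ 0 :=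
      Finset.sum_nonpos fun j hj => by
        have := mul_nonneg (Int.natCast_nonneg (f j)) (hterm j hj)
        linarith
    linarith

/-- A positivity preserving automorphism of the root datum permutes the simple roots. -/
lemma IsRootAut.mem_support [Finite ι] {g : X ≃ₗ[ℤ] X} {π : Equiv.Perm ι} (h : IsRootAut R g π)
    (hpos : ∀ i, b.IsPos (π i) ↔ b.IsPos i) {i : ι} (hi : i ∈ b.support) : π i ∈ b.support := by
  have key : ∀ j, b.IsPos j → R.root j ∈ AddSubmonoid.closure (R.root '' b.support) := fun j hj =>
    by
      obtain ⟨f, hf⟩ := exists_root_eq_sum_of_isPos hj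
      rw [hf]
      exact sum_mem fun m hm =>
        nsmul_mem (AddSubmonoid.subset_closure (Set.mem_image_of_mem _ hm)) _
  obtain ⟨j, hj, hij⟩ := exists_map_root_eq (b := b) (J := b.support) subset_rfl g
    (fun j hj => by rw [h.map_root]; exact key _ ((hpos j).mpr (b.isPos_of_mem_support hj)))
    (fun j hj => by
      change g⁻¹ (R.root j) ∈ _
      rw [h.inv.map_root]
      refine key _ ((hpos _).mp ?_)
      rw [show π (π⁻¹ j) = j from π.apply_symm_apply j]
      exact b.isPos_of_mem_support hj) hi
  rw [h.map_root] at hij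
  rwa [R.root.injective hij]

/-- If a positivity preserving automorphism maps the Levi part of the base into itself, then it
preserves the positive roots outside the Levi part. -/
lemma IsRootAut.pairing_pos_iff [Finite ι] {g : X ≃ₗ[ℤ] X} {π : Equiv.Perm ι}
    (h : IsRootAut R g π) (hpos : ∀ i, b.IsPos (π i) ↔ b.IsPos i) {μ : Y}
    (hμ : ∀ i, b.IsPos i → 0 ≤ R.toLinearMap (R.root i) μ)
    (hI : ∀ i ∈ leviBase R b μ, π i ∈ leviBase R b μ) (i : ι) :
    0 < R.toLinearMap (R.root (π i)) μ ↔ 0 < R.toLinearMap (R.root i) μ := by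
  have hI' : ∀ i ∈ leviBase R b μ, π⁻¹ i ∈ leviBase R b μ := fun i hi => by
    obtain ⟨j, hj, rfl⟩ := (((Set.toFinite _).injOn_iff_bijOn_of_mapsTo hI).mp
      π.injective.injOn).surjOn hi
    rwa [show π⁻¹ (π j) = j from π.symm_apply_apply j]
  have key : ∀ {g' : X ≃ₗ[ℤ] X} {π' : Equiv.Perm ι}, IsRootAut R g' π' →
      (∀ i ∈ leviBase R b μ, π' i ∈ leviBase R b μ) → ∀ {i}, b.IsPos i → b.IsPos (π' i) →
      0 < R.toLinearMap (R.root (π' i)) μ → 0 < R.toLinearMap (R.root i) μ := by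
    intro g' π' h hI i hi _ hlt
    refine (hμ i hi).lt_of_ne fun h0 => ?_
    have hmem := root_mem_closure_leviBase hμ hi h0.symm
    have hmap : ∀ x ∈ AddSubmonoid.closure (R.root '' leviBase R b μ),
        g' x ∈ AddSubmonoid.closure (R.root '' leviBase R b μ) := by
      intro x hx
      induction hx using AddSubmonoid.closure_induction with
      | mem x hx =>
        obtain ⟨j, hj, rfl⟩ := hx
        rw [h.map_root]
        exact AddSubmonoid.subset_closure ⟨_, hI j hj, rfl⟩
      | zero => rw [map_zero]; exact zero_mem _
      | add x y _ _ hx hy => rw [map_add]; exact add_mem hx hy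
    have := pairing_eq_zero_of_mem_closure_leviBase (hmap _ hmem)
    rw [h.map_root] at this
    omega
  constructor
  · intro hlt
    have hi := isPos_of_pairing_pos hμ hlt
    exact key h hI ((hpos i).mp hi) hi hlt
  · intro hlt
    have hi := isPos_of_pairing_pos hμ hlt
    refine key h.inv hI' ((hpos i).mpr hi) ?_ ?_ <;>
      rwa [show π⁻¹ (π i) = i from π.symm_apply_apply i]

lemma exists_isRootAut_of_mem_reflectionSubgroup {K : Set ι} {w : X ≃ₗ[ℤ] X}
    (hw : w ∈ reflectionSubgroup R K) : ∃ π, IsRootAut R w π := by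
  obtain ⟨l, -, rfl⟩ := exists_list_of_mem_reflectionSubgroup hw
  exact ⟨_, IsRootAut.list_prod l⟩

lemma pairing_apply_of_mem_reflectionSubgroup {μ : Y} {w : X ≃ₗ[ℤ] X}
    (hw : w ∈ reflectionSubgroup R (leviBase R b μ)) (x : X) :
    R.toLinearMap (w x) μ = R.toLinearMap x μ := by
  obtain ⟨l, hl, rfl⟩ := exists_list_of_mem_reflectionSubgroup hw
  clear hw
  induction l with
  | nil => rfl
  | cons i l ih =>
    have h := ih (fun j hj => hl j (List.mem_cons_of_mem i hj))
    rw [List.map_cons, List.prod_cons, LinearEquiv.mul_apply, R.reflection_apply, map_sub,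
      LinearMap.sub_apply, h, map_smul, LinearMap.smul_apply, (hl i List.mem_cons_self).2,
      smul_zero, sub_zero]

/-- The longest element `w` of `W_I` induces a permutation `i ↦ -w i` of `I`. -/
lemma IsLongestElement.exists_neg_root [Finite ι] {μ : Y}
    (hμ : ∀ i, b.IsPos i → 0 ≤ R.toLinearMap (R.root i) μ) {w : X ≃ₗ[ℤ] X}
    (hw : IsLongestElement R b (leviBase R b μ) w) {i : ι} (hi : i ∈ leviBase R b μ) :
    (∃ j ∈ leviBase R b μ, w (R.root i) = -R.root j) ∧
      ∃ j ∈ leviBase R b μ, w.symm (R.root i) = -R.root j := by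
  have hI : leviBase R b μ ⊆ b.support := fun i hi => hi.1
  obtain ⟨π, hπ⟩ := exists_isRootAut_of_mem_reflectionSubgroup hw.1
  have hμw := pairing_apply_of_mem_reflectionSubgroup hw.1
  have hμw' := pairing_apply_of_mem_reflectionSubgroup (inv_mem hw.1)
  set M := AddSubmonoid.closure (R.root '' leviBase R b μ)
  have h1 : ∀ j ∈ leviBase R b μ, -w (R.root j) ∈ M := by
    intro j hj
    have hneg := (isPos_negIndex _).mpr (hw.not_isPos hI hπ hj)
    rw [hπ.map_root, ← root_negIndex]
    refine root_mem_closure_leviBase hμ hneg ?_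
    rw [root_negIndex, map_neg, LinearMap.neg_apply, ← hπ.map_root, hμw, hj.2, neg_zero]
  have h1' : ∀ x ∈ M, -w x ∈ M := by
    intro x hx
    induction hx using AddSubmonoid.closure_induction with
    | mem x hx =>
      obtain ⟨j, hj, rfl⟩ := hx
      exact h1 j hj
    | zero => simp
    | add x y _ _ hx hy => rw [map_add, neg_add]; exact add_mem hx hy
  have h2 : ∀ j ∈ leviBase R b μ, -w.symm (R.root j) ∈ M := by
    intro j hj
    have hroot : w.symm (R.root j) = R.root (π⁻¹ j) := hπ.inv.map_root j
    have hzero : R.toLinearMap (R.root (π⁻¹ j)) μ = 0 := by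
      rw [← hπ.inv.map_root, hμw', hj.2]
    rw [hroot, ← root_negIndex]
    refine root_mem_closure_leviBase hμ ((isPos_negIndex _).mpr fun hpos => ?_) ?_
    · -- otherwise both the root of `j` and its negative are sums of simple roots
      have h3 := h1' _ (root_mem_closure_leviBase hμ hpos hzero)
      rw [← hroot, w.apply_symm_apply] at h3
      obtain ⟨N, ht, hN, hht⟩ := exists_heightFunctional R b
      have h4 : ∀ x ∈ M, 0 ≤ ht x := by
        intro x hx
        induction hx using AddSubmonoid.closure_induction with
        | mem x hx =>
          obtain ⟨m, hm, rfl⟩ := hx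
          rw [hht m hm.1]
          exact hN.le
        | zero => simp
        | add x y _ _ hx hy => rw [map_add]; exact add_nonneg hx hy
      have h5 := h4 _ h3
      rw [map_neg, hht j hj.1] at h5
      omega
    · rw [root_negIndex, map_neg, LinearMap.neg_apply, hzero, neg_zero]
  let e : X ≃ₗ[ℤ] X := w.trans (LinearEquiv.neg ℤ)
  have he : ∀ x, e x = -w x := fun x => rfl
  have he' : ∀ x, e.symm x = -w.symm x := fun x => by
    rw [LinearEquiv.symm_apply_eq, he, map_neg, w.apply_symm_apply, neg_neg]
  constructor
  · obtain ⟨j, hj, h⟩ := exists_map_root_eq hI e (fun j hj => by rw [he]; exact h1 j hj)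
      (fun j hj => by rw [he']; exact h2 j hj) hi
    exact ⟨j, hj, by rw [← h, he, neg_neg]⟩
  · obtain ⟨j, hj, h⟩ := exists_map_root_eq hI e.symm (fun j hj => by rw [he']; exact h2 j hj)
      (fun j hj => by rw [e.symm_symm, he]; exact h1 j hj) hi
    exact ⟨j, hj, by rw [← h, he', neg_neg]⟩

/-! ### The Hasse cone of a root datum with a twist -/

/-- The equivalence of the neighborhood property, the inclusion of the Griffiths–Schmid cone and the
condition `σ = -w` on `I`, for a positivity preserving automorphism `σ` of a root datum. -/
theorem tfae_of_isRootAut [Finite ι] [Module.Finite ℤ X]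
    (b : R.Base) (q : ℕ) (hq : 2 ≤ q) {μ : Y}
    (hμ : ∀ i, b.IsPos i → 0 ≤ R.toLinearMap (R.root i) μ) {w : X ≃ₗ[ℤ] X}
    (hw : IsLongestElement R b (leviBase R b μ) w) {σ : X ≃ₗ[ℤ] X} {π : Equiv.Perm ι}
    (hσ : IsRootAut R σ π) (hpos : ∀ i, b.IsPos (π i) ↔ b.IsPos i) :
    List.TFAE [
      IsNeighborhoodIn (realCone (dominant R (leviBase R b μ)))
        (realCone ((fun x => x - q • w (σ.symm x)) '' dominant R (b.support : Set ι)))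
        (toReal '' {x | (∀ i ∈ leviBase R b μ, R.toLinearMap x (R.coroot i) = 0) ∧
          ∀ i ∈ b.support, i ∉ leviBase R b μ → R.toLinearMap x (R.coroot i) < 0}),
      {x | (∀ i ∈ leviBase R b μ, 0 ≤ R.toLinearMap x (R.coroot i)) ∧
        ∀ i, 0 < R.toLinearMap (R.root i) μ → R.toLinearMap x (R.coroot i) ≤ 0} ⊆
        saturation ((fun x => x - q • w (σ.symm x)) '' dominant R (b.support : Set ι)),
      ∀ i ∈ leviBase R b μ, σ (R.root i) = -w (R.root i)] := by
  have := isAddTorsionFree R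
  have : Module.Free ℤ X := inferInstance
  obtain ⟨πw, hπw⟩ := exists_isRootAut_of_mem_reflectionSubgroup hw.1
  obtain ⟨N, ϖ, hN, hϖ, hϖ'⟩ := exists_fundamentalWeights R b
  set ρ : Equiv.Perm ι := πw * π⁻¹ with hρ
  have hA : IsRootAut R (w * σ⁻¹) ρ := hπw.mul hσ.inv
  have hτroot : ∀ i, R.root (negIndex R (ρ⁻¹ i)) = -σ (w.symm (R.root i)) := fun i => by
    rw [root_negIndex, ← hA.inv.map_root, mul_inv_rev, inv_inv]
    rfl
  have hneg := fun {i} (hi : i ∈ leviBase R b μ) => hw.exists_neg_root hμ hi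
  have hiff : (∀ i ∈ leviBase R b μ, negIndex R (ρ⁻¹ i) = i) ↔
      ∀ i ∈ leviBase R b μ, σ (R.root i) = -w (R.root i) := by
    constructor
    · intro H j hj
      obtain ⟨i, hi, hij⟩ := (hneg hj).1
      have := hτroot i
      rw [H i hi, ← neg_eq_iff_eq_neg.mpr hij, map_neg, map_neg, w.symm_apply_apply,
        neg_neg] at this
      exact this.symm
    · intro H i hi
      obtain ⟨j, hj, hij⟩ := (hneg hi).2
      apply R.root.injective
      rw [hτroot, hij, map_neg, neg_neg, H j hj, ← map_neg, ← hij, w.apply_symm_apply]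
  rw [← hiff]
  exact TwistedSystem.tfae {
    coroot := fun i => R.toLinearMap.flip (R.coroot i)
    Δ := b.support
    I := leviBase R b μ
    S := {i | 0 < R.toLinearMap (R.root i) μ}
    I_subset := fun i hi => hi.1
    mem_S := fun i hi hiI => (hμ i (b.isPos_of_mem_support hi)).lt_of_ne fun h => hiI ⟨hi, h.symm⟩
    N := N
    N_pos := hN
    weight := ϖ
    coroot_weight_self := hϖ
    coroot_weight_of_ne := hϖ'
    q := q
    two_le_q := hq
    A := (w * σ⁻¹ : X ≃ₗ[ℤ] X)
    τ := fun i => negIndex R (ρ⁻¹ i)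
    τ_mem := fun i hi => by
      obtain ⟨j, hj, hij⟩ := (hneg hi).2
      have h := hτroot i
      rw [hij, map_neg, neg_neg, hσ.map_root] at h
      rw [R.root.injective h]
      exact hσ.mem_support hpos hj.1
    τ_injOn := fun i _ j _ hij => by
      have h := congrArg R.root hij
      simp only [hτroot, neg_inj] at h
      exact R.root.injective (w.symm.injective (σ.injective h))
    coroot_A := fun i _ x => by
      have h := hA.pairing_map x (ρ⁻¹ i)
      rw [show ρ (ρ⁻¹ i) = i from ρ.apply_symm_apply i] at h
      rw [coroot_negIndex, map_neg, LinearMap.neg_apply, neg_neg]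
      exact h
    coroot_neg_of_regular := fun x h0 h1 s hs => pairing_coroot_neg hμ h0 h1 hs
    exists_coroot_A := fun H s hs => by
      have hπI : ∀ i ∈ leviBase R b μ, π i ∈ leviBase R b μ := fun i hi => by
        obtain ⟨j, hj, hij⟩ := (hneg hi).1
        have h := hiff.mp H i hi
        rw [hij, neg_neg, hσ.map_root] at h
        rwa [R.root.injective h]
      refine ⟨ρ s, ?_, fun x => hA.pairing_map x s⟩
      change 0 < R.toLinearMap (R.root (πw (π⁻¹ s))) μ
      rw [← hπw.map_root, pairing_apply_of_mem_reflectionSubgroup hw.1,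
        ← hσ.pairing_pos_iff hpos hμ hπI, show π (π⁻¹ s) = s from π.apply_symm_apply s]
      exact hs }

end RootDatum

/-! ### Characters of tori -/

section Characters

variable {k : Type*} [Field k] {n : ℕ}

/-- Regular functions on a group restrict to linear combinations of the products of characters that
generate the restrictions of the coordinates. -/
lemma mem_span_of_mem_glRing {T : Subgroup (GL (Fin n) k)} (M : Subgroup (T →* kˣ))
    (hentry : ∀ i j, (fun t : T => ((t : GL (Fin n) k) : Matrix (Fin n) (Fin n) k) i j) ∈
      Submodule.span k ((fun χ : T →* kˣ => fun t => (χ t : k)) '' M))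
    (hdet : (fun t : T => ((t : GL (Fin n) k) : Matrix (Fin n) (Fin n) k).det⁻¹) ∈
      Submodule.span k ((fun χ : T →* kˣ => fun t => (χ t : k)) '' M))
    {F : GL (Fin n) k → k} (hF : F ∈ glRing k n) :
    (fun t : T => F t) ∈ Submodule.span k ((fun χ : T →* kˣ => fun t => (χ t : k)) '' M) := by
  induction hF using Algebra.adjoin_induction with
  | mem f hf =>
    rcases hf with ⟨i, j, rfl⟩ | hf
    · exact hentry i j
    · rw [Set.mem_singleton_iff] at hf
      subst hf
      exact hdet
  | algebraMap r =>
    have h : (fun _ : T => r) = r • fun t => (((1 : T →* kˣ) t : kˣ) : k) := by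
      funext t; simp
    change (fun _ : T => r) ∈ _
    rw [h]
    exact Submodule.smul_mem _ _ (Submodule.subset_span ⟨1, one_mem M, rfl⟩)
  | add f g _ _ hf hg => exact Submodule.add_mem _ hf hg
  | mul f g _ _ hf hg =>
    have h := Submodule.mul_mem_mul hf hg
    rw [Submodule.span_mul_span] at h
    refine Submodule.span_mono ?_ h
    rintro _ ⟨_, ⟨χ, hχ, rfl⟩, _, ⟨ψ, hψ, rfl⟩, rfl⟩
    exact ⟨χ * ψ, mul_mem hχ hψ, by funext t; simp⟩

/-- The character lattice of a torus is finitely generated: by the linear independence of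
characters, every character is a monomial in the diagonal coordinates. -/
lemma IsTorus.finite_charLattice {T : Subgroup (GL (Fin n) k)} (hT : IsTorus T) :
    Module.Finite ℤ (CharLattice T) := by
  obtain ⟨x, hx⟩ := hT.diagonalizable
  have hdiag : ∀ t : T, ∃ v : Fin n → k,
      ((x * t * x⁻¹ : GL (Fin n) k) : Matrix (Fin n) (Fin n) k) = Matrix.diagonal v := fun t =>
    ⟨_, (hx t t.2).diagonal_diag.symm⟩
  let d₀ : Fin n → T →* k := fun l =>
    { toFun := fun t => ((x * t * x⁻¹ : GL (Fin n) k) : Matrix (Fin n) (Fin n) k) l l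
      map_one' := by simp
      map_mul' := fun s t => by
        obtain ⟨v, hv⟩ := hdiag s
        obtain ⟨v', hv'⟩ := hdiag t
        have h : x * ((s * t : T) : GL (Fin n) k) * x⁻¹ = (x * s * x⁻¹) * (x * t * x⁻¹) := by
          rw [Subgroup.coe_mul]; group
        rw [h, Units.val_mul, hv, hv', Matrix.diagonal_mul_diagonal]
        simp }
  let d : Fin n → T →* kˣ := fun l => (d₀ l).toHomUnits
  have hd : ∀ t : T, ((x * t * x⁻¹ : GL (Fin n) k) : Matrix (Fin n) (Fin n) k) =
      Matrix.diagonal fun l => (d l t : k) := fun t => (hx t t.2).diagonal_diag.symm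
  set M : Subgroup (T →* kˣ) := Subgroup.closure (Set.range d) with hM
  have hdM : ∀ l, d l ∈ M := fun l => Subgroup.subset_closure ⟨l, rfl⟩
  have hle : charGroup T ≤ M := by
    intro χ hχ
    obtain ⟨⟨F, hF, hF'⟩, -⟩ := hχ
    have h1 := mem_span_of_mem_glRing M (fun i j => ?_) ?_ hF
    · have h2 : (fun t : T => F t) = fun t => (χ t : k) := funext fun t => (hF' t).symm
      rw [h2] at h1
      by_contra hχM
      refine (linearIndependent_monoidHom T k).notMem_span_image
        (s := (fun χ : T →* kˣ => (Units.coeHom k).comp χ) '' M)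
        (x := (Units.coeHom k).comp χ) ?_ ?_
      · rintro ⟨ψ, hψ, h⟩
        refine hχM ?_
        have : ψ = χ := by
          ext t
          exact DFunLike.congr_fun h t
        rwa [← this]
      · rw [Set.image_image]
        exact h1
    · have h : (fun t : T => ((t : GL (Fin n) k) : Matrix (Fin n) (Fin n) k) i j) =
          ∑ l, ((x⁻¹ : GL (Fin n) k) i l * x l j) • fun t => (d l t : k) := by
        funext t
        have h3 : (t : GL (Fin n) k) = x⁻¹ * (x * t * x⁻¹) * x := by group
        rw [h3, Units.val_mul, Units.val_mul, hd, Matrix.mul_apply, Finset.sum_apply]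
        refine Finset.sum_congr rfl fun l _ => ?_
        rw [Matrix.mul_diagonal, Pi.smul_apply, smul_eq_mul]
        ring
      rw [h]
      exact Submodule.sum_mem _ fun l _ => Submodule.smul_mem _ _
        (Submodule.subset_span ⟨d l, hdM l, rfl⟩)
    · refine Submodule.subset_span ⟨∏ l, (d l)⁻¹, prod_mem fun l _ => inv_mem (hdM l), ?_⟩
      funext t
      have h3 : (t : GL (Fin n) k) = x⁻¹ * (x * t * x⁻¹) * x := by group
      have h4 : ((t : GL (Fin n) k) : Matrix (Fin n) (Fin n) k).det = ∏ l, (d l t : k) := by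
        have h5 : ((x * t * x⁻¹ : GL (Fin n) k) : Matrix (Fin n) (Fin n) k).det =
            ((t : GL (Fin n) k) : Matrix (Fin n) (Fin n) k).det := by
          rw [Units.val_mul, Units.val_mul, Matrix.det_mul_right_comm, ← Units.val_mul,
            mul_inv_cancel, Units.val_one, one_mul]
        rw [← h5, hd, Matrix.det_diagonal]
      rw [h4]
      simp [Units.coe_prod]
  have hfg : Module.Finite ℤ (Additive M) := by
    rw [Module.Finite.iff_addGroup_fg, ← GroupFG.iff_add_fg, Group.fg_iff_subgroup_fg]
    exact ⟨(Set.finite_range d).toFinset, by simp [hM]⟩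
  exact Module.Finite.of_injective
    (MonoidHom.toAdditive (Subgroup.inclusion hle)).toIntLinearMap
    (Subgroup.inclusion_injective hle)

end Characters

/-! ### Field automorphisms acting on root data -/

section Twist

variable {k : Type*} [Field k] {n : ℕ}

lemma glMap_symm_glMap (τ : k ≃+* k) (g : GL (Fin n) k) : glMap τ.symm (glMap τ g) = g := by
  ext i j
  simp

lemma glMap_glMap_symm (τ : k ≃+* k) (g : GL (Fin n) k) : glMap τ (glMap τ.symm g) = g := by
  ext i j
  simp

lemma glMap_mem {H : Subgroup (GL (Fin n) k)} {τ : k ≃+* k} (hH : H.map (glMap τ) = H)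
    {g : GL (Fin n) k} (hg : g ∈ H) : glMap τ g ∈ H :=
  hH ▸ Subgroup.mem_map_of_mem _ hg

lemma mem_of_glMap_mem {H : Subgroup (GL (Fin n) k)} {τ : k ≃+* k} (hH : H.map (glMap τ) = H)
    {g : GL (Fin n) k} (hg : glMap τ g ∈ H) : g ∈ H := by
  rw [← glMap_symm_glMap τ g]
  exact glMap_symm_mem hH hg

lemma gaRing_twist (τ : k ≃+* k) {f : k → k} (hf : f ∈ gaRing k) :
    (fun x => τ (f (τ.symm x))) ∈ gaRing k := by
  induction hf using Algebra.adjoin_induction with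
  | mem f hf =>
    rw [Set.mem_singleton_iff] at hf
    subst hf
    exact Algebra.subset_adjoin (by rw [Set.mem_singleton_iff]; funext x; simp)
  | algebraMap r => exact (gaRing k).algebraMap_mem (τ r)
  | add f g _ _ hf hg => simpa using! add_mem hf hg
  | mul f g _ _ hf hg => simpa using! mul_mem hf hg

lemma gmRing_twist (τ : k ≃+* k) {f : kˣ → k} (hf : f ∈ gmRing k) :
    (fun t => τ (f (Units.map (τ.symm : k →* k) t))) ∈ gmRing k := by
  induction hf using Algebra.adjoin_induction with
  | mem f hf =>
    rcases hf with rfl | hf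
    · exact Algebra.subset_adjoin (Or.inl (by funext t; simp))
    · rw [Set.mem_singleton_iff] at hf
      subst hf
      refine Algebra.subset_adjoin (Or.inr ?_)
      rw [Set.mem_singleton_iff]
      funext t
      change τ (((Units.map (τ.symm : k →* k) t)⁻¹ : kˣ) : k) = _
      rw [← map_inv]
      simp
  | algebraMap r => exact (gmRing k).algebraMap_mem (τ r)
  | add f g _ _ hf hg => simpa using! add_mem hf hg
  | mul f g _ _ hf hg => simpa using! mul_mem hf hg

lemma sl2Ring_twist (τ : k ≃+* k) {f : SL(2, k) → k} (hf : f ∈ sl2Ring k) :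
    (fun g => τ (f (Matrix.SpecialLinearGroup.map (τ.symm : k →+* k) g))) ∈ sl2Ring k := by
  induction hf using Algebra.adjoin_induction with
  | mem f hf =>
    obtain ⟨i, j, rfl⟩ := hf
    exact Algebra.subset_adjoin ⟨i, j, by funext t; simp⟩
  | algebraMap r => exact (sl2Ring k).algebraMap_mem (τ r)
  | add f g _ _ hf hg => simpa using! add_mem hf hg
  | mul f g _ _ hf hg => simpa using! mul_mem hf hg

variable {Fq : Type*} [Field Fq] [Fintype Fq] [Algebra Fq k] [Algebra.IsAlgebraic Fq k]
  {G : Subgroup (GL (Fin n) k)} {D : BorelPair Fq G}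

lemma twist_symm {H : Subgroup (GL (Fin n) k)} (τ : k ≃+* k) (hH : H.map (glMap τ) = H)
    (χ : CharLattice H) : twist τ.symm (map_glMap_symm hH) χ = (twist τ hH).symm χ := rfl

lemma charEval_twist {H : Subgroup (GL (Fin n) k)} (τ : k ≃+* k) (hH : H.map (glMap τ) = H)
    (χ : CharLattice H) (h : H) : (charEval (twist τ hH χ) h : k) =
      τ (charEval χ ⟨glMap τ.symm h, glMap_symm_mem hH h.2⟩) := rfl

/-- The conjugate of a root homomorphism by a field automorphism. -/
lemma IsRootHom.twist (τ : k ≃+* k) (hG : G.map (glMap τ) = G) (hT : D.T.map (glMap τ) = D.T)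
    {α : CharLattice D.T} {u : k → GL (Fin n) k} (hu : IsRootHom D α u) :
    IsRootHom D (HasseType.twist τ hT α) (fun x => glMap τ (u (τ.symm x))) where
  mem x := glMap_mem hG (hu.mem _)
  map_add x y := by rw [_root_.map_add, hu.map_add, map_mul]
  regular i j := gaRing_twist τ (hu.regular i j)
  conj t x := by
    have h := congrArg (glMap τ) (hu.conj ⟨glMap τ.symm t, glMap_symm_mem hT t.2⟩ (τ.symm x))
    rw [map_mul, map_mul, map_inv, glMap_glMap_symm] at h
    rw [h, charEval_twist]
    simp
  closed_immersion := by
    obtain ⟨F, hF, h⟩ := hu.closed_immersion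
    exact ⟨_, glRing_twist τ hF, fun x => by rw [glMap_symm_glMap, h, τ.apply_symm_apply]⟩

/-- The conjugate of a cocharacter by a field automorphism. -/
def twistCochar (τ : k ≃+* k) (hT : D.T.map (glMap τ) = D.T) (c : CocharLattice D) :
    CocharLattice D :=
  Additive.ofMul ⟨{
    toFun := fun t => ⟨glMap τ (cocharEval c (Units.map (τ.symm : k →* k) t)),
      glMap_mem hT (cocharEval c _).2⟩
    map_one' := Subtype.ext (by simp [cocharEval])
    map_mul' := fun s t => Subtype.ext (by simp [cocharEval]) },
    fun i j => gmRing_twist τ (c.toMul.2.1 i j), fun i j => by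
      have h := gmRing_twist τ (c.toMul.2.2 i j)
      convert h using 2 with t
      change ((glMap τ (cocharEval c _))⁻¹ : GL (Fin n) k).val i j = _
      rw [← map_inv]
      rfl⟩

lemma cocharEval_twistCochar (τ : k ≃+* k) (hT : D.T.map (glMap τ) = D.T) (c : CocharLattice D)
    (t : kˣ) : (cocharEval (twistCochar τ hT c) t : GL (Fin n) k) =
      glMap τ (cocharEval c (Units.map (τ.symm : k →* k) t)) := rfl

/-- A field automorphism maps roots and coroots to roots and coroots. -/
lemma IsRootCorootPair.twist (τ : k ≃+* k) (hG : G.map (glMap τ) = G)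
    (hT : D.T.map (glMap τ) = D.T) {α : CharLattice D.T} {c : CocharLattice D}
    (h : IsRootCorootPair D α c) :
    IsRootCorootPair D (HasseType.twist τ hT α) (twistCochar τ hT c) := by
  obtain ⟨φ, h1, h2, h3, h4, h5⟩ := h
  have hup : ∀ x : k, Matrix.SpecialLinearGroup.map (τ.symm : k →+* k) (sl2Upper x) =
      sl2Upper (τ.symm x) := fun x => by
    ext i j
    change τ.symm ((sl2Upper x).val i j) = _
    fin_cases i <;> fin_cases j <;> simp [sl2Upper]
  have hlow : ∀ x : k, Matrix.SpecialLinearGroup.map (τ.symm : k →+* k) (sl2Lower x) =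
      sl2Lower (τ.symm x) := fun x => by
    ext i j
    change τ.symm ((sl2Lower x).val i j) = _
    fin_cases i <;> fin_cases j <;> simp [sl2Lower]
  have hdiag : ∀ t : kˣ, Matrix.SpecialLinearGroup.map (τ.symm : k →+* k) (sl2Diag t) =
      sl2Diag (Units.map (τ.symm : k →* k) t) := fun t => by
    ext i j
    change τ.symm ((sl2Diag t).val i j) = _
    fin_cases i <;> fin_cases j <;> simp [sl2Diag]
  refine ⟨(glMap τ).comp (φ.comp (Matrix.SpecialLinearGroup.map (τ.symm : k →+* k))),
    fun g => glMap_mem hG (h1 _), fun i j => sl2Ring_twist τ (h2 i j), ?_, ?_, fun t => ?_⟩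
  · simpa [hup] using h3.twist τ hG hT
  · simpa [hlow] using h4.twist τ hG hT
  · rw [cocharEval_twistCochar, ← h5, ← hdiag]
    rfl

lemma eq_of_forall_zpow_eq [Infinite k] {a b : ℤ} (h : ∀ t : kˣ, t ^ a = t ^ b) : a = b := by
  by_contra hab
  have h1 : ∀ t : kˣ, t ^ (a - b).natAbs = 1 := fun t => by
    have h2 : t ^ (a - b) = 1 := by rw [zpow_sub, h, mul_inv_cancel]
    rcases Int.natAbs_eq (a - b) with h3 | h3 <;> rw [h3] at h2 <;> simpa using h2
  have h0 : (Polynomial.X ^ (a - b).natAbs - 1 : Polynomial k) = 0 := by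
    refine Polynomial.eq_zero_of_infinite_isRoot _
      ((Set.finite_singleton (0 : k)).infinite_compl.mono fun x hx => ?_)
    have hx' : x ≠ 0 := hx
    have h2 := congrArg Units.val (h1 (Units.mk0 x hx'))
    simpa [Polynomial.IsRoot, sub_eq_zero] using h2
  have := congrArg (Polynomial.eval 0) h0
  simp [zero_pow (Int.natAbs_ne_zero.mpr (sub_ne_zero.mpr hab))] at this

variable {ι : Type*} {R : RootDatum ι (CharLattice D.T) (CocharLattice D)}

lemma pairing_twist [Infinite k] (hR : IsRootDatumOf D R) (τ : k ≃+* k)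
    (hT : D.T.map (glMap τ) = D.T) (χ : CharLattice D.T) (c : CocharLattice D) :
    R.toLinearMap (twist τ hT χ) (twistCochar τ hT c) = R.toLinearMap χ c := by
  refine eq_of_forall_zpow_eq (k := k) fun t => ?_
  rw [← hR.pairing]
  apply Units.ext
  rw [charEval_twist]
  have h : (⟨glMap τ.symm (cocharEval (twistCochar τ hT c) t : GL (Fin n) k),
      glMap_symm_mem hT (cocharEval (twistCochar τ hT c) t).2⟩ : D.T) =
        cocharEval c (Units.map (τ.symm : k →* k) t) :=
    Subtype.ext (glMap_symm_glMap τ _)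
  rw [h, hR.pairing, ← map_zpow]
  simp

/-- A field automorphism that stabilizes `G` and `T` acts on the root datum. -/
lemma exists_isRootAut_twist [Infinite k] [Finite ι] (hR : IsRootDatumOf D R) (τ : k ≃+* k)
    (hG : G.map (glMap τ) = G) (hT : D.T.map (glMap τ) = D.T) :
    ∃ π, IsRootAut R (twist τ hT).toIntLinearEquiv π := by
  have h : ∀ i, ∃ j, R.root j = twist τ hT (R.root i) ∧
      R.coroot j = twistCochar τ hT (R.coroot i) := fun i => by
    have h1 : IsRootCorootPair D (R.root i) (R.coroot i) :=
      hR.roots.subset ⟨i, rfl⟩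
    obtain ⟨j, hj⟩ := hR.roots.superset (show (_, _) ∈ _ from h1.twist τ hG hT)
    exact ⟨j, congrArg Prod.fst hj, congrArg Prod.snd hj⟩
  choose p hp hp' using h
  have hinj : Function.Injective p := fun i j hij => by
    apply R.root.injective
    apply (twist τ hT).injective
    rw [← hp, ← hp, hij]
  refine ⟨Equiv.ofBijective p (Finite.injective_iff_bijective.mp hinj), fun i => (hp i).symm,
    fun x i => ?_⟩
  change R.toLinearMap (twist τ hT x) (R.coroot (p i)) = _
  rw [hp', pairing_twist hR]

lemma exists_isRootHom (hR : IsRootDatumOf D R) (i : ι) :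
    (∃ u, IsRootHom D (R.root i) u) ∧ ∃ u, IsRootHom D (-R.root i) u := by
  obtain ⟨φ, -, -, h3, h4, -⟩ : IsRootCorootPair D (R.root i) (R.coroot i) :=
    hR.roots.subset ⟨i, rfl⟩
  exact ⟨⟨_, h3⟩, ⟨_, h4⟩⟩

/-- A field automorphism that stabilizes `G`, `T` and `B` preserves positive roots. -/
lemma isPos_twist_iff {b : R.Base} (hb : IsSimpleSystemOf R b) (τ : k ≃+* k)
    (hG : G.map (glMap τ) = G) (hT : D.T.map (glMap τ) = D.T) (hB : D.B.map (glMap τ) = D.B)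
    {π : Equiv.Perm ι} (hπ : IsRootAut R (twist τ hT).toIntLinearEquiv π) (i : ι) :
    b.IsPos (π i) ↔ b.IsPos i := by
  have hroot : R.root (π i) = twist τ hT (R.root i) := (hπ.map_root i).symm
  rw [hb, hb]
  constructor
  · intro h u hu x
    have h1 := hu.twist τ hG hT
    rw [map_neg, ← hroot] at h1
    have h2 := h _ h1 (τ x)
    rw [τ.symm_apply_apply] at h2
    exact mem_of_glMap_mem hB h2
  · intro h u hu x
    have h1 := hu.twist τ.symm (map_glMap_symm hG) (map_glMap_symm hT)
    rw [map_neg, hroot, twist_symm τ hT, (twist τ hT).symm_apply_apply] at h1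
    have h2 := h _ h1 (τ.symm x)
    rw [τ.symm_symm, τ.apply_symm_apply] at h2
    exact mem_of_glMap_mem (map_glMap_symm hB) h2

/-! ### The parabolic subgroup of a cocharacter -/

/-- The functions on `kˣ` that extend to polynomial functions on `k`. -/
noncomputable def polyRing (k : Type*) [Field k] : Subalgebra k (kˣ → k) :=
  (Polynomial.aeval (fun t : kˣ => (t : k))).range

lemma mem_polyRing {f : kˣ → k} :
    f ∈ polyRing k ↔ ∃ p : Polynomial k, ∀ t : kˣ, f t = p.eval (t : k) := by
  have h : ∀ (p : Polynomial k) (t : kˣ),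
      Polynomial.aeval (fun t : kˣ => (t : k)) p t = p.eval (t : k) := fun p t => by
    rw [← Polynomial.coe_aeval_eq_eval]
    exact (Polynomial.aeval_algHom_apply (Pi.evalAlgHom k (fun _ : kˣ => k) t) _ p).symm
  constructor
  · rintro ⟨p, rfl⟩
    exact ⟨p, h p⟩
  · rintro ⟨p, hp⟩
    exact ⟨p, funext fun t => (h p t).trans (hp t).symm⟩

/-- The matrix `μ(t)⁻¹ g μ(t)`. -/
def conjCochar (μ : CocharLattice D) (g : GL (Fin n) k) (t : kˣ) : GL (Fin n) k :=
  (cocharEval μ t : GL (Fin n) k)⁻¹ * g * (cocharEval μ t : GL (Fin n) k)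

/-- The map `t ↦ μ(t)⁻¹ g μ(t)` extends to `t = 0` as a map to matrices. -/
def ExtendsToZero (μ : CocharLattice D) (g : GL (Fin n) k) : Prop :=
  ∀ i j, (fun t => (conjCochar μ g t : Matrix (Fin n) (Fin n) k) i j) ∈ polyRing k

lemma ExtendsToZero.mul {μ : CocharLattice D} {g h : GL (Fin n) k} (hg : ExtendsToZero μ g)
    (hh : ExtendsToZero μ h) : ExtendsToZero μ (g * h) := by
  intro i j
  have : (fun t => (conjCochar μ (g * h) t : Matrix (Fin n) (Fin n) k) i j) =
      ∑ l, (fun t => (conjCochar μ g t : Matrix (Fin n) (Fin n) k) i l) *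
        fun t => (conjCochar μ h t : Matrix (Fin n) (Fin n) k) l j := by
    funext t
    have h1 : conjCochar μ (g * h) t = conjCochar μ g t * conjCochar μ h t := by
      simp only [conjCochar]; group
    rw [h1, Units.val_mul, Matrix.mul_apply, Finset.sum_apply]
    rfl
  rw [this]
  exact sum_mem fun l _ => mul_mem (hg i l) (hh l j)

lemma ExtendsToZero.of_mem_T {μ : CocharLattice D} {g : GL (Fin n) k} (hg : g ∈ D.T) :
    ExtendsToZero μ g := by
  intro i j
  have h : ∀ t, conjCochar μ g t = g := fun t => by
    have := congrArg Subtype.val (D.isMaximalTorus.isTorus.mul_comm ⟨g, hg⟩ (cocharEval μ t))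
    simp only [Subgroup.coe_mul] at this
    rw [conjCochar, mul_assoc, this, inv_mul_cancel_left]
  simp only [h]
  exact (polyRing k).algebraMap_mem _

lemma ExtendsToZero.comp_mem_polyRing {μ : CocharLattice D} {g : GL (Fin n) k}
    (hg : ExtendsToZero μ g) {F : GL (Fin n) k → k} (hF : F ∈ glRing k n) :
    (fun t => F (conjCochar μ g t)) ∈ polyRing k := by
  induction hF using Algebra.adjoin_induction with
  | mem f hf =>
    rcases hf with ⟨i, j, rfl⟩ | hf
    · exact hg i j
    · rw [Set.mem_singleton_iff] at hf
      subst hf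
      -- the determinant is invariant under conjugation
      have h : ∀ t, (conjCochar μ g t : Matrix (Fin n) (Fin n) k).det =
          (g : Matrix (Fin n) (Fin n) k).det := fun t => by
        rw [conjCochar, Units.val_mul, Units.val_mul, Matrix.det_mul_right_comm, ← Units.val_mul,
          inv_mul_cancel, Units.val_one, one_mul]
      simp only [h]
      exact (polyRing k).algebraMap_mem _
  | algebraMap r => exact (polyRing k).algebraMap_mem r
  | add f g _ _ hf hg => exact add_mem hf hg
  | mul f g _ _ hf hg => exact mul_mem hf hg

lemma conjCochar_rootHom (hR : IsRootDatumOf D R) {α : CharLattice D.T} {u : k → GL (Fin n) k}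
    (hu : IsRootHom D α u) (μ : CocharLattice D) (x : k) (t : kˣ) :
    conjCochar μ (u x) t = u (((t ^ (-R.toLinearMap α μ) : kˣ) : k) * x) := by
  have h := hu.conj (cocharEval μ t)⁻¹ x
  have h2 : charEval α (cocharEval μ t)⁻¹ = t ^ (-R.toLinearMap α μ) := by
    rw [zpow_neg, ← hR.pairing]
    exact map_inv (α.toMul : D.T →* kˣ) _
  rw [h2, Subgroup.coe_inv, inv_inv] at h
  exact h

lemma ExtendsToZero.of_isRootHom (hR : IsRootDatumOf D R) {α : CharLattice D.T}
    {u : k → GL (Fin n) k} (hu : IsRootHom D α u) {μ : CocharLattice D}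
    (hμ : R.toLinearMap α μ ≤ 0) (x : k) : ExtendsToZero μ (u x) := by
  have key : ∀ f ∈ gaRing k,
      (fun t : kˣ => f (((t ^ (-R.toLinearMap α μ) : kˣ) : k) * x)) ∈ polyRing k := by
    obtain ⟨m, hm⟩ := Int.eq_ofNat_of_zero_le (neg_nonneg.mpr hμ)
    intro f hf
    induction hf using Algebra.adjoin_induction with
    | mem f hf =>
      rw [Set.mem_singleton_iff] at hf
      subst hf
      exact mem_polyRing.mpr ⟨Polynomial.X ^ m * Polynomial.C x, fun t => by
        rw [hm, zpow_natCast, Units.val_pow_eq_pow_val, Polynomial.eval_mul, Polynomial.eval_pow,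
          Polynomial.eval_X, Polynomial.eval_C]⟩
    | algebraMap r => exact (polyRing k).algebraMap_mem r
    | add f g _ _ hf hg => exact add_mem hf hg
    | mul f g _ _ hf hg => exact mul_mem hf hg
  intro i j
  simp only [conjCochar_rootHom hR hu]
  exact key _ (hu.regular i j)

lemma ExtendsToZero.of_mem_parabolic (hR : IsRootDatumOf D R) {μ : CocharLattice D}
    {g : GL (Fin n) k} (hg : g ∈ parabolic R μ) : ExtendsToZero μ g := by
  suffices h : ExtendsToZero μ g ∧ ExtendsToZero μ g⁻¹ from h.1
  induction hg using Subgroup.closure_induction with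
  | mem g hg =>
    rcases hg with hg | ⟨i, u, x, hi, hu, rfl⟩
    · exact ⟨.of_mem_T hg, .of_mem_T (inv_mem hg)⟩
    · have h0 : u 0 = 1 := by simpa using hu.map_add 0 0
      have hinv : (u x)⁻¹ = u (-x) := by
        rw [inv_eq_iff_mul_eq_one, ← hu.map_add, add_neg_cancel, h0]
      exact ⟨.of_isRootHom hR hu hi x, hinv ▸ .of_isRootHom hR hu hi (-x)⟩
  | one => exact ⟨.of_mem_T (one_mem _), .of_mem_T (by simp)⟩
  | mul g h _ _ hg hh => exact ⟨hg.1.mul hh.1, by rw [mul_inv_rev]; exact hh.2.mul hg.2⟩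
  | inv g _ hg => exact ⟨hg.2, by rw [inv_inv]; exact hg.1⟩

/-- A root group contained in the parabolic subgroup of `μ` has a root that is nonpositive on `μ`,
since `t ↦ t⁻ᵐ` does not extend to `t = 0` for `m > 0`. -/
lemma pairing_nonpos_of_mem_parabolic [Infinite k] (hR : IsRootDatumOf D R) {α : CharLattice D.T}
    {u : k → GL (Fin n) k} (hu : IsRootHom D α u) {μ : CocharLattice D}
    (hmem : ∀ x, u x ∈ parabolic R μ) : R.toLinearMap α μ ≤ 0 := by
  by_contra! hpos
  obtain ⟨m, hm⟩ := Int.eq_ofNat_of_zero_le hpos.le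
  obtain ⟨F, hF, hFu⟩ := hu.closed_immersion
  obtain ⟨p, hp⟩ := mem_polyRing.mp
    ((ExtendsToZero.of_mem_parabolic hR (hmem 1)).comp_mem_polyRing hF)
  simp only [conjCochar_rootHom hR hu, hFu, mul_one] at hp
  have h0 : Polynomial.X ^ m * p - 1 = 0 := by
    refine Polynomial.eq_zero_of_infinite_isRoot _
      ((Set.finite_singleton (0 : k)).infinite_compl.mono fun x hx => ?_)
    have hx' : x ≠ 0 := hx
    have h := hp (Units.mk0 x hx')
    rw [Units.val_mk0] at h
    simp [Polynomial.IsRoot, ← h, hm, hx']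
  have h1 := congrArg (Polynomial.eval 0) h0
  have hm0 : m ≠ 0 := by omega
  simp [hm0] at h1

lemma pairing_nonneg_of_isPos [Infinite k] (hR : IsRootDatumOf D R) {b : R.Base}
    (hb : IsSimpleSystemOf R b) {μ : CocharLattice D} (hμ : D.B ≤ parabolic R μ) {i : ι}
    (hi : b.IsPos i) : 0 ≤ R.toLinearMap (R.root i) μ := by
  obtain ⟨u, hu⟩ := (exists_isRootHom hR i).2
  have h := pairing_nonpos_of_mem_parabolic hR hu fun x => hμ ((hb i).mp hi u hu x)
  rw [map_neg, LinearMap.neg_apply] at h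
  omega

/-- If the action of a field automorphism on the roots preserves those that are nonpositive on `μ`,
then the automorphism stabilizes the parabolic subgroup of `μ`. -/
lemma map_parabolic_eq (τ : k ≃+* k) (hG : G.map (glMap τ) = G) (hT : D.T.map (glMap τ) = D.T)
    {π : Equiv.Perm ι} (hπ : IsRootAut R (twist τ hT).toIntLinearEquiv π) {μ : CocharLattice D}
    (h : ∀ i, R.toLinearMap (R.root (π i)) μ ≤ 0 ↔ R.toLinearMap (R.root i) μ ≤ 0) :
    (parabolic R μ).map (glMap τ) = parabolic R μ := by
  have hroot : ∀ i, R.root (π i) = twist τ hT (R.root i) := fun i => (hπ.map_root i).symm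
  rw [parabolic, MonoidHom.map_closure]
  congr 1
  apply Set.Subset.antisymm
  · rintro _ ⟨g, hg | ⟨i, u, x, hi, hu, rfl⟩, rfl⟩
    · exact Or.inl (glMap_mem hT hg)
    · refine Or.inr ⟨π i, _, τ x, (h i).mpr hi, hroot i ▸ hu.twist τ hG hT, ?_⟩
      rw [τ.symm_apply_apply]
  · intro g hg
    refine ⟨glMap τ.symm g, ?_, glMap_glMap_symm τ g⟩
    rcases hg with hg | ⟨i, u, x, hi, hu, rfl⟩
    · exact Or.inl (glMap_symm_mem hT hg)
    · obtain ⟨j, rfl⟩ := π.surjective i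
      have h1 := hu.twist τ.symm (map_glMap_symm hG) (map_glMap_symm hT)
      rw [hroot, twist_symm τ hT, (twist τ hT).symm_apply_apply] at h1
      refine Or.inr ⟨j, _, τ.symm x, (h j).mp hi, h1, ?_⟩
      rw [τ.symm_symm, τ.apply_symm_apply]

end Twist

end HasseType

/-! ### Partial Hasse invariant cones of reductive groups -/

theorem mainTheorem5
    {Fq : Type*} [Field Fq] [Fintype Fq]
    {k : Type*} [Field k] [IsAlgClosed k] [Algebra Fq k] [Algebra.IsAlgebraic Fq k]
    {n : ℕ} (G : Subgroup (GL (Fin n) k))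
    (hG : HasseType.IsConnectedReductive G) (hGq : HasseType.IsDefinedOver Fq G)
    (D : HasseType.BorelPair Fq G)
    {ι : Type*} [Finite ι]
    (R : RootDatum ι (HasseType.CharLattice D.T) (HasseType.CocharLattice D))
    (hR : HasseType.IsRootDatumOf D R)
    (b : R.Base) (hb : HasseType.IsSimpleSystemOf R b)
    (μ : HasseType.CocharLattice D) (hμ : D.B ≤ HasseType.parabolic R μ)
    (w₀I : HasseType.CharLattice D.T ≃ₗ[ℤ] HasseType.CharLattice D.T)
    (hw : HasseType.IsLongestElement R b (HasseType.parabolicType R b μ) w₀I) :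
    List.TFAE [
      HasseType.IsNeighborhoodIn
        (HasseType.realCone (HasseType.dominant R (HasseType.parabolicType R b μ)))
        (HasseType.realCone (HasseType.pHaCone R b w₀I))
        (HasseType.toReal '' HasseType.leviRegular R b μ),
      HasseType.gsCone R b μ ⊆ HasseType.saturation (HasseType.pHaCone R b w₀I),
      HasseType.IsDefinedOver Fq (HasseType.parabolic R μ) ∧
        ∀ i ∈ HasseType.parabolicType R b μ,
          HasseType.frobChar D (R.root i) = -(w₀I (R.root i))] := by
  open HasseType in
  have : Infinite k := IsAlgClosed.instInfinite
  have hpos : ∀ i, b.IsPos i → 0 ≤ R.toLinearMap (R.root i) μ := fun i =>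
    pairing_nonneg_of_isPos hR hb hμ
  have : Module.Finite ℤ (CharLattice D.T) := D.isMaximalTorus.isTorus.finite_charLattice
  obtain ⟨π, hπ⟩ := exists_isRootAut_twist hR (frob Fq k) hGq D.T_defined
  have hπpos := isPos_twist_iff hb (frob Fq k) hGq D.T_defined D.B_defined hπ
  have hmain := tfae_of_isRootAut b (Fintype.card Fq) Fintype.one_lt_card hpos hw hπ hπpos
  -- the inequalities of the Griffiths–Schmid cone, in terms of the pairing with `μ`
  have hgs : gsCone R b μ = {x | (∀ i ∈ leviBase R b μ, 0 ≤ R.toLinearMap x (R.coroot i)) ∧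
      ∀ i, 0 < R.toLinearMap (R.root i) μ → R.toLinearMap x (R.coroot i) ≤ 0} := by
    ext x
    refine and_congr_right fun _ => ⟨fun h i hi => h i (isPos_of_pairing_pos hpos hi) hi.ne',
      fun h i hi hi' => h i ((hpos i hi).lt_of_ne (Ne.symm hi'))⟩
  have hlast : (IsDefinedOver Fq (parabolic R μ) ∧
      ∀ i ∈ parabolicType R b μ, frobChar D (R.root i) = -(w₀I (R.root i))) ↔
        ∀ i ∈ leviBase R b μ, frobChar D (R.root i) = -w₀I (R.root i) := by
    refine ⟨fun h => h.2, fun h => ⟨?_, h⟩⟩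
    -- the condition on roots shows that Frobenius preserves `I`
    have hI : ∀ i ∈ leviBase R b μ, π i ∈ leviBase R b μ := fun i hi => by
      obtain ⟨j, hj, hij⟩ := (hw.exists_neg_root hpos hi).1
      have h1 := h i hi
      rw [hij, neg_neg] at h1
      have h2 : R.root (π i) = R.root j := (hπ.map_root i).symm.trans h1
      rwa [R.root.injective h2]
    refine map_parabolic_eq (frob Fq k) hGq D.T_defined hπ fun i => ?_
    rw [← not_lt, ← not_lt, hπ.pairing_pos_iff hπpos hpos hI]
  rw [hlast, hgs]
  exact hmain
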